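/- **Setting.** Let $m\ge 1$, let $\mathcal X\subset\mathbb R^d$ be closed and convex with at least two points, and let $\mathcal Y=\{y=(y_0,\dots,y_m)\in\mathbb R^{m+1}: y_i\ge 0,\ \sum_i y_i=1\}$, $\mathcal Z=\mathcal X\times\mathcal Y$. Let $\xi=(\xi_0,\dots,\xi_m)$ be a random vector with values in $\Xi_0\times\dots\times\Xi_m$, let $F_i(x,\xi_i)$, $i=0,\dots,m$, be continuous and convex in $x\in\mathcal X$ for each value of $\xi_i$, and measurable and integrable in $\xi$ for each $x\in\mathcal X$; let $r_0:=r$ and $r_1,\dots,r_m$ be real. Put $\Phi(x,y,\xi)=\sum_{i=0}^m y_i(F_i(x,\xi_i)-r_i)$ and $\phi(x,y)=\mathbb E[\Phi(x,y,\xi)]$. For chosen (jointly measurable) subgradients $F_i'(x,\xi_i)\in\partial F_i(x,\xi_i)$ put $$G_x(x,y,\xi)=\sum_{i=0}^m y_iF_i'(x,\xi_i),\quad G_y(x,y,\xi)=(F_i(x,\xi_i)-r_i)_{i=0}^m,\quad G=(G_x,-G_y),\quad g_x=\mathbb E[G_x],\ g_y=\mathbb E[G_y].$$ Let $\|\cdot\|_x,\|\cdot\|_y$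 be norms on $\mathbb R^d,\mathbb R^{m+1}$ with dual norms $\|\cdot\|_{*,x},\|\cdot\|_{*,y}$. Let $\omega_x:\mathcal X\to\mathbb R$ be continuous, $\alpha_x$-strongly convex with respect to $\|\cdot\|_x$ ($\alpha_x>0$), and continuously differentiable on $\mathcal X^o=\{x\in\mathcal X:\partial\omega_x(x)\ne\emptyset\}$, with $D_x:=\sqrt{\max_{\mathcal X}\omega_x-\min_{\mathcal X}\omega_x}<\infty$; let $\omega_y:\mathcal Y\to\mathbb R$, $\alpha_y$, $D_y$ be likewise for $\mathcal Y$ and $\|\cdot\|_y$. Put $\omega_z(x,y)=\frac{\omega_x(x)}{2D_x^2}+\frac{\omega_y(y)}{2D_y^2}$, $V(z',z)=\omega_z(z)-[\omega_z(z')+\nabla\omega_z(z')^\top(z-z')]$ and $P_{z'}(\zeta)=\operatorname{argmin}_{z\in\mathcal Z}\{\zeta^\top(z-z')+V(z',z)\}$. Assume that for all $x\in\mathcal X$, $y\in\mathcal Y$ the expectations $g_x,g_y$ are well defined with $g_x(x,y)\in\partial_x\phi(x,y)$ and $-g_y(x,y)\in\partial_y[-\phi(x,y)]$, and that for positive constants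 $M_x,M_y,Q$ $$\mathbb E\big[e^{\|G_x(x,y,\xi)\|_{*,x}^2/M_x^2}\big]\le e,\qquad \mathbb E\big[e^{\|G_y(x,y,\xi)\|_{*,y}^2/M_y^2}\big]\le e,\qquad \mathbb E\big[e^{|\Phi(x,y,\xi)-\phi(x,y)|^2/Q^2}\big]\le e .$$ Let $M=\sqrt{\frac{2D_x^2}{\alpha_x}M_x^2+\frac{2D_y^2}{\alpha_y}M_y^2}$, let $\epsilon_{\mathcal A}>0$ and $\delta\in(0,1)$, and let $\Omega(\delta)=\max\{\sqrt{12\ln(24/\delta)},\tfrac43\ln(24/\delta)\}$. **Algorithm (OVSMD).** Let $\xi^{(0)},\xi^{(1)},\dots$ be i.i.d. copies of $\xi$ and $\gamma_t=\frac1{M\sqrt{t+1}}$. Start from $z^{(0)}=(x^{(0)},y^{(0)})\in\operatorname{argmin}_{\mathcal Z}\omega_z$ and let $z^{(t+1)}=(x^{(t+1)},y^{(t+1)})=P_{z^{(t)}}(\gamma_tG(x^{(t)},y^{(t)},\xi^{(t)}))$ for $t\ge0$. Put $$u_*^{(t)}=\max_{y\in\mathcal Y}\frac{\sum_{s=0}^t\gamma_s[\phi(x^{(s)},y^{(s)})+g_y(x^{(s)},y^{(s)})^\top(y-y^{(s)})]}{\sum_{s=0}^t\gamma_s},\qquad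 l_*^{(t)}=\min_{x\in\mathcal X}\frac{\sum_{s=0}^t\gamma_s[\phi(x^{(s)},y^{(s)})+g_x(x^{(s)},y^{(s)})^\top(x-x^{(s)})]}{\sum_{s=0}^t\gamma_s},$$ and let $\hat u_*^{(t)}$, $\hat l_*^{(t)}$ be defined in the same way with $\Phi(x^{(s)},y^{(s)},\xi^{(s)})$, $G_y(x^{(s)},y^{(s)},\xi^{(s)})$, $G_x(x^{(s)},y^{(s)},\xi^{(s)})$ in place of $\phi(x^{(s)},y^{(s)})$, $g_y(x^{(s)},y^{(s)})$, $g_x(x^{(s)},y^{(s)})$. **Proposition.** (i) $\mathrm{Prob}\{u_*^{(t)}-l_*^{(t)}>\epsilon_{\mathcal A}\}\le\delta$ for every integer $$t\ \ge\ \max\left\{6,\left(\frac{8(10M\Omega(\delta)+4.5M)}{\epsilon_{\mathcal A}}\ln\frac{4(10M\Omega(\delta)+4.5M)}{\epsilon_{\mathcal A}}\right)^2-2\right\}.$$ (ii) $\mathrm{Prob}\{|\hat l_*^{(t)}-l_*^{(t)}|>\epsilon_{\mathcal A}\}\le\delta$ and $\mathrm{Prob}\{|\hat u_*^{(t)}-u_*^{(t)}|>\epsilon_{\mathcal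 A}\}\le\delta$ for every integer $$t\ \ge\ \max\left\{6,\left(\frac{8(Q\Omega(\delta)+8M\Omega(\delta)+2.5M)}{\epsilon_{\mathcal A}}\ln\frac{4(Q\Omega(\delta)+8M\Omega(\delta)+2.5M)}{\epsilon_{\mathcal A}}\right)^2-2\right\}.$$ -/

import Mathlib

open MeasureTheory ProbabilityTheory Set

noncomputable section

namespace OVSMD

/-- Vectors of `ℝⁿ`; `inner ℝ u v` is the dot product `uᵀ v`. -/
abbrev Vec (n : ℕ) : Type := EuclideanSpace ℝ (Fin n)

/-- The unit simplex `{y : y_i ≥ 0, ∑ y_i = 1}` of `ℝⁿ`. -/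
def simplex (n : ℕ) : Set (Vec n) := {y | (∀ i, 0 ≤ y i) ∧ ∑ i, y i = 1}

/-- The subdifferential at `x` of a function `f : S → ℝ`. -/
def subdiff {n : ℕ} (S : Set (Vec n)) (f : Vec n → ℝ) (x : Vec n) : Set (Vec n) :=
  {v | ∀ w ∈ S, f x + inner ℝ v (w - x) ≤ f w}

/-- The dual norm `‖ζ‖_* = sup {ζᵀ v : ‖v‖ ≤ 1}` of a norm `N` on `ℝⁿ`. -/
def dualNorm {n : ℕ} (N : Seminorm ℝ (Vec n)) (ζ : Vec n) : ℝ :=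
  sSup ((fun v => inner ℝ ζ v) '' {v | N v ≤ 1})

/-- The points of `S` at which `f : S → ℝ` has a subgradient (written `Sᵒ`). -/
def subdiffDomain {n : ℕ} (S : Set (Vec n)) (f : Vec n → ℝ) : Set (Vec n) :=
  {x | x ∈ S ∧ (subdiff S f x).Nonempty}

/-- A norm `N` on `ℝⁿ` together with a distance-generating function `fn : S → ℝ` of modulus `α`
with respect to `N`: `fn` is continuous on `S`, `α`-strongly convex with respect to `N`,
continuously differentiable (relative to `S`, with gradient `grad`) on `Sᵒ`, and the diameter
of `S` with respect to `fn` is finite. -/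
structure DistGen {n : ℕ} (S : Set (Vec n)) where
  N : Seminorm ℝ (Vec n)
  definite : ∀ v, N v = 0 → v = 0
  fn : Vec n → ℝ
  grad : Vec n → Vec n
  α : ℝ
  α_pos : 0 < α
  continuousOn : ContinuousOn fn S
  strongConvex : ∀ x ∈ S, ∀ w ∈ S, ∀ a b : ℝ, 0 ≤ a → 0 ≤ b → a + b = 1 →
    fn (a • x + b • w) ≤ a * fn x + b * fn w - α / 2 * (a * b) * N (x - w) ^ 2
  hasGrad : ∀ x ∈ subdiffDomain S fn, HasGradientWithinAt fn (grad x) S x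
  continuousOn_grad : ContinuousOn grad (subdiffDomain S fn)
  bddAbove : BddAbove (fn '' S)

/-- The diameter `D = √(max_S fn - min_S fn)`. -/
def DistGen.diam {n : ℕ} {S : Set (Vec n)} (D : DistGen S) : ℝ :=
  Real.sqrt (sSup (D.fn '' S) - sInf (D.fn '' S))

/-- The data of a stochastic program with expectation constraints
`min_{x ∈ X} E[F_0(x, ξ_0)]` s.t. `E[F_i(x, ξ_i)] ≤ r_i`, `i = 1, …, m`; the entry `r 0` is the
level parameter.  The random vector `(ξ_0, …, ξ_m)` has the joint distribution `law`. -/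
structure SOEC (d m : ℕ) (Ξ : Fin (m + 1) → Type*) [∀ i, MeasurableSpace (Ξ i)] where
  X : Set (Vec d)
  isClosed : IsClosed X
  convex : Convex ℝ X
  F : ∀ i, Vec d → Ξ i → ℝ
  r : Fin (m + 1) → ℝ
  law : Measure (∀ i, Ξ i)
  isProb : IsProbabilityMeasure law
  F_continuous : ∀ i (s : Ξ i), ContinuousOn (fun x => F i x s) X
  F_convex : ∀ i (s : Ξ i), ConvexOn ℝ X (fun x => F i x s)
  F_measurable : ∀ i, ∀ x ∈ X, Measurable (F i x)
  F_integrable : ∀ i, ∀ x ∈ X, Integrable (fun s : ∀ i, Ξ i => F i x (s i)) law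

section

variable {d m : ℕ} {Ξ : Fin (m + 1) → Type*} [∀ i, MeasurableSpace (Ξ i)] (p : SOEC d m Ξ)

/-- `Φ(x, y, ξ) = ∑ y_i (F_i(x, ξ_i) - r_i)`. -/
def SOEC.Phi (x : Vec d) (y : Vec (m + 1)) (s : ∀ i, Ξ i) : ℝ :=
  ∑ i, y i * (p.F i x (s i) - p.r i)

/-- `φ(x, y) = E[Φ(x, y, ξ)]`. -/
def SOEC.phi (x : Vec d) (y : Vec (m + 1)) : ℝ := ∫ s, p.Phi x y s ∂p.law

/-- `G_x(x, y, ξ) = ∑ y_i F'_i(x, ξ_i)`, for a choice `F'` of stochastic subgradients. -/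
def Gx (F' : ∀ i, Vec d → Ξ i → Vec d) (x : Vec d) (y : Vec (m + 1)) (s : ∀ i, Ξ i) : Vec d :=
  ∑ i, y i • F' i x (s i)

/-- `G_y(x, y, ξ) = (F_i(x, ξ_i) - r_i)_{i = 0, …, m}`, which does not depend on `y`. -/
def SOEC.Gy (x : Vec d) (s : ∀ i, Ξ i) : Vec (m + 1) :=
  WithLp.toLp 2 (fun i => p.F i x (s i) - p.r i)

/-- `g_x(x, y) = E[G_x(x, y, ξ)]`. -/
def SOEC.gx (F' : ∀ i, Vec d → Ξ i → Vec d) (x : Vec d) (y : Vec (m + 1)) : Vec d :=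
  ∫ s, Gx F' x y s ∂p.law

/-- `g_y(x, y) = E[G_y(x, y, ξ)]`. -/
def SOEC.gy (x : Vec d) : Vec (m + 1) := ∫ s, p.Gy x s ∂p.law

/-- The light-tail assumption on the stochastic first-order information: `F'_i(x, ξ_i)` is a
subgradient of `F_i(·, ξ_i)`, the expectation `g = (g_x, -g_y)` of `G = (G_x, -G_y)` is well
defined and consists of subgradients of `φ(·, y)` and `-φ(x, ·)`, and the three exponential
moment bounds hold with the constants `Mx, My, Q > 0`. -/
structure LightTail (dx : DistGen p.X) (dy : DistGen (simplex (m + 1)))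
    (F' : ∀ i, Vec d → Ξ i → Vec d) (Mx My Q : ℝ) : Prop where
  F'_measurable : ∀ i, Measurable (fun q : p.X × Ξ i => F' i (q.1 : Vec d) q.2)
  F'_mem : ∀ i, ∀ x ∈ p.X, ∀ s : Ξ i, F' i x s ∈ subdiff p.X (fun w => p.F i w s) x
  G_integrable : ∀ x ∈ p.X, ∀ y ∈ simplex (m + 1),
    Integrable (Gx F' x y) p.law ∧ Integrable (p.Gy x) p.law
  gx_mem : ∀ x ∈ p.X, ∀ y ∈ simplex (m + 1), p.gx F' x y ∈ subdiff p.X (fun w => p.phi w y) x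
  gy_mem : ∀ x ∈ p.X, ∀ y ∈ simplex (m + 1),
    -p.gy x ∈ subdiff (simplex (m + 1)) (fun w => -p.phi x w) y
  Mx_pos : 0 < Mx
  My_pos : 0 < My
  Q_pos : 0 < Q
  Gx_tail : ∀ x ∈ p.X, ∀ y ∈ simplex (m + 1),
    ∫⁻ s, ENNReal.ofReal (Real.exp (dualNorm dx.N (Gx F' x y s) ^ 2 / Mx ^ 2)) ∂p.law
      ≤ ENNReal.ofReal (Real.exp 1)
  Gy_tail : ∀ x ∈ p.X,
    ∫⁻ s, ENNReal.ofReal (Real.exp (dualNorm dy.N (p.Gy x s) ^ 2 / My ^ 2)) ∂p.law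
      ≤ ENNReal.ofReal (Real.exp 1)
  Phi_tail : ∀ x ∈ p.X, ∀ y ∈ simplex (m + 1),
    ∫⁻ s, ENNReal.ofReal (Real.exp (|p.Phi x y s - p.phi x y| ^ 2 / Q ^ 2)) ∂p.law
      ≤ ENNReal.ofReal (Real.exp 1)

end

section

variable {d k : ℕ} {X : Set (Vec d)} {Y : Set (Vec k)} (dx : DistGen X) (dy : DistGen Y)

/-- The pairing `ζᵀ z` on `ℝᵈ × ℝᵏ`. -/
def pairing (ζ z : Vec d × Vec k) : ℝ := inner ℝ ζ.1 z.1 + inner ℝ ζ.2 z.2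

/-- `ω_z(x, y) = ω_x(x) / (2 D_x²) + ω_y(y) / (2 D_y²)`. -/
def omegaZ (z : Vec d × Vec k) : ℝ :=
  dx.fn z.1 / (2 * dx.diam ^ 2) + dy.fn z.2 / (2 * dy.diam ^ 2)

/-- The gradient of `ω_z`. -/
def gradZ (z : Vec d × Vec k) : Vec d × Vec k :=
  ((1 / (2 * dx.diam ^ 2)) • dx.grad z.1, (1 / (2 * dy.diam ^ 2)) • dy.grad z.2)

/-- The Bregman divergence `V(z', z)` of `ω_z`. -/
def bregman (z' z : Vec d × Vec k) : ℝ :=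
  omegaZ dx dy z - (omegaZ dx dy z' + pairing (gradZ dx dy z') (z - z'))

/-- `z` is the value `P_{z'}(ζ) = argmin_{z ∈ X × Y} {ζᵀ(z - z') + V(z', z)}` of the
prox-mapping. -/
def IsProx (z' ζ z : Vec d × Vec k) : Prop :=
  z ∈ X ×ˢ Y ∧ IsMinOn (fun w => pairing ζ (w - z') + bregman dx dy z' w) (X ×ˢ Y) z

/-- `M = √(2 D_x² M_x² / α_x + 2 D_y² M_y² / α_y)`. -/
def constM (Mx My : ℝ) : ℝ :=
  Real.sqrt (2 * dx.diam ^ 2 / dx.α * Mx ^ 2 + 2 * dy.diam ^ 2 / dy.α * My ^ 2)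

end

/-- `Ω(δ) = max {√(12 ln(24/δ)), (4/3) ln(24/δ)}`. -/
def constOmega (δ : ℝ) : ℝ :=
  max (Real.sqrt (12 * Real.log (24 / δ))) (4 / 3 * Real.log (24 / δ))

/-- The number `max {6, ((8 C / ε) ln (4 C / ε))² - 2}` of iterations. -/
def iterBound (C ε : ℝ) : ℝ :=
  max 6 ((8 * C / ε * Real.log (4 * C / ε)) ^ 2 - 2)

section

variable {d m : ℕ} {Ξ : Fin (m + 1) → Type*} [∀ i, MeasurableSpace (Ξ i)] (p : SOEC d m Ξ)

/-- `(x t, y t)` are the iterates of online-validation stochastic mirror descent with step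
sizes `γ t` run on the samples `ξ t`: they start at a minimizer of `ω_z` over `X × Y`, and
`z^{(t+1)} = P_{z^{(t)}}(γ_t G(x^{(t)}, y^{(t)}, ξ^{(t)}))` with `G = (G_x, -G_y)`. -/
structure IsRun (dx : DistGen p.X) (dy : DistGen (simplex (m + 1)))
    (F' : ∀ i, Vec d → Ξ i → Vec d) (γ : ℕ → ℝ) {Ω : Type*} (ξ : ℕ → Ω → ∀ i, Ξ i)
    (x : ℕ → Ω → Vec d) (y : ℕ → Ω → Vec (m + 1)) : Prop where
  init : ∀ o, (x 0 o, y 0 o) ∈ p.X ×ˢ simplex (m + 1) ∧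
    IsMinOn (omegaZ dx dy) (p.X ×ˢ simplex (m + 1)) (x 0 o, y 0 o)
  step : ∀ t o, IsProx dx dy (x t o, y t o)
    (γ t • (Gx F' (x t o) (y t o) (ξ t o), -p.Gy (x t o) (ξ t o))) (x (t + 1) o, y (t + 1) o)

/-- `∑_{s ≤ t} γ_s a_s / ∑_{s ≤ t} γ_s`. -/
def wavg (γ a : ℕ → ℝ) (t : ℕ) : ℝ :=
  (∑ s ∈ Finset.range (t + 1), γ s * a s) / ∑ s ∈ Finset.range (t + 1), γ s

/-- The online validation upper bound `u_*^{(t)}` along a trajectory `(x s, y s)`. -/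
def uStar (γ : ℕ → ℝ) (x : ℕ → Vec d) (y : ℕ → Vec (m + 1)) (t : ℕ) : ℝ :=
  sSup ((fun w => wavg γ (fun s => p.phi (x s) (y s) + inner ℝ (p.gy (x s)) (w - y s)) t) ''
    simplex (m + 1))

/-- The online validation lower bound `l_*^{(t)}` along a trajectory `(x s, y s)`. -/
def lStar (F' : ∀ i, Vec d → Ξ i → Vec d) (γ : ℕ → ℝ) (x : ℕ → Vec d) (y : ℕ → Vec (m + 1))
    (t : ℕ) : ℝ :=
  sInf ((fun w => wavg γ
    (fun s => p.phi (x s) (y s) + inner ℝ (p.gx F' (x s) (y s)) (w - x s)) t) '' p.X)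

/-- The stochastic estimate `û_*^{(t)}` along a trajectory `(x s, y s)` with samples `ξ s`. -/
def uHat (γ : ℕ → ℝ) (ξ : ℕ → ∀ i, Ξ i) (x : ℕ → Vec d) (y : ℕ → Vec (m + 1)) (t : ℕ) : ℝ :=
  sSup ((fun w => wavg γ
    (fun s => p.Phi (x s) (y s) (ξ s) + inner ℝ (p.Gy (x s) (ξ s)) (w - y s)) t) ''
      simplex (m + 1))

/-- The stochastic estimate `l̂_*^{(t)}` along a trajectory `(x s, y s)` with samples `ξ s`. -/
def lHat (F' : ∀ i, Vec d → Ξ i → Vec d) (γ : ℕ → ℝ) (ξ : ℕ → ∀ i, Ξ i) (x : ℕ → Vec d)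
    (y : ℕ → Vec (m + 1)) (t : ℕ) : ℝ :=
  sInf ((fun w => wavg γ
    (fun s => p.Phi (x s) (y s) (ξ s) + inner ℝ (Gx F' (x s) (y s) (ξ s)) (w - x s)) t) '' p.X)

end

end OVSMD

end

/-! Everything reduces to linear regret. In `uStar - lStar` the values of φ cancel, leaving the
supremum over (x, y) of the weighted average of g_xᵀ(x_s - x) - g_yᵀ(y_s - y). The errors of the two
estimates are bounded by the uniform distance over the block between the two affine functions being
optimized. Since ω_z is separable, the prox-step splits, and each block runs its own mirror descent
with the regularizer ω / (2D²), whose oscillation is at most 1/2.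

In one block, the regret against the mean oracle g is the regret against the sampled oracle G,
bounded pathwise by `DistGen.mirrorDescent_regret`, plus the noise Σ γ_s ⟨Δ_s, w - v_s⟩ with Δ_s =
G_s - g_s. The relevant w may depend on all samples, so this sum is not a martingale. A ghost
sequence W_s, produced by dual averaging on -γ_s Δ_s, repairs this: its regret against every w is
bounded pathwise by `DistGen.dualAveraging_regret`, and Σ γ_s ⟨Δ_s, W_s - v_s⟩ is a martingale
because W_s and v_s depend only on past samples. This is `DistGen.measure_noise_gt_le`.

Two tail bounds suffice. Martingales have conditionally sub-Gaussian increments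
(`lintegral_exp_mul_le`), whence a Chernoff bound (`measure_sum_gt_le`). The sums Σ γ_s² ‖G_s‖² are
handled by convexity of exp and Markov's inequality (`measure_weighted_sum_gt_le`). Each of the
three probabilities is a union of six events of probability at most δ/24. Outside them the error,
before division by Σ γ_s, is at most a constant times H = Σ 1/(s+1), and `iterBound` makes this at
most ε Σ γ_s (`mul_sum_inv_le_of_iterBound`). -/

namespace OVSMD

/-! ### Norms on ℝⁿ and their duals -/

section Norms

variable {n : ℕ} {N : Seminorm ℝ (Vec n)}

lemma seminorm_le_mul_norm (N : Seminorm ℝ (Vec n)) : ∃ C : ℝ, 0 ≤ C ∧ ∀ v, N v ≤ C * ‖v‖ := by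
  refine ⟨∑ i, N (EuclideanSpace.single i 1), Finset.sum_nonneg fun i _ => apply_nonneg _ _,
    fun v => ?_⟩
  have hv : v = ∑ i, v i • (EuclideanSpace.single i (1 : ℝ) : Vec n) := by
    ext j
    simp [Finset.sum_apply, Pi.single_apply]
  calc N v = N (∑ i, v i • (EuclideanSpace.single i (1 : ℝ) : Vec n)) := by rw [← hv]
    _ ≤ ∑ i, N (v i • (EuclideanSpace.single i (1 : ℝ) : Vec n)) := by
      induction (Finset.univ : Finset (Fin n)) using Finset.induction_on with
      | empty => simp
      | insert a s ha ih =>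
        rw [Finset.sum_insert ha, Finset.sum_insert ha]
        exact (map_add_le_add N _ _).trans (by gcongr)
    _ ≤ ∑ i, N (EuclideanSpace.single i (1 : ℝ)) * ‖v‖ := by
      refine Finset.sum_le_sum fun i _ => ?_
      rw [map_smul_eq_mul, mul_comm]
      gcongr
      exact PiLp.norm_apply_le v i
    _ = _ := by rw [Finset.sum_mul]

lemma continuous_of_le_mul_norm {f : Vec n → ℝ} (hadd : ∀ v w, f (v + w) ≤ f v + f w)
    {C : ℝ} (hC : ∀ v, f v ≤ C * ‖v‖) : Continuous f := by
  have hL : LipschitzWith (Real.toNNReal (max C 0)) f := by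
    refine LipschitzWith.of_le_add_mul' _ fun v w => ?_
    have h1 := hadd w (v - w)
    have h2 := hC (v - w)
    have h3 : C * ‖v - w‖ ≤ max C 0 * ‖v - w‖ := by gcongr; exact le_max_left _ _
    rw [add_sub_cancel] at h1
    rw [dist_eq_norm]
    linarith
  exact hL.continuous

lemma seminorm_continuous (N : Seminorm ℝ (Vec n)) : Continuous N := by
  obtain ⟨C, -, hC⟩ := seminorm_le_mul_norm N
  exact continuous_of_le_mul_norm (map_add_le_add N) hC

lemma norm_le_mul_seminorm (hN : ∀ v, N v = 0 → v = 0) :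
    ∃ c : ℝ, 0 < c ∧ ∀ v, ‖v‖ ≤ c * N v := by
  rcases (Metric.sphere (0 : Vec n) 1).eq_empty_or_nonempty with h | h
  · refine ⟨1, one_pos, fun v => ?_⟩
    rcases eq_or_ne v 0 with rfl | hv
    · simp
    · exfalso
      have : ‖v‖⁻¹ • v ∈ Metric.sphere (0 : Vec n) 1 := by
        simp [norm_smul, inv_mul_cancel₀ (norm_ne_zero_iff.2 hv)]
      rw [h] at this
      exact this
  · obtain ⟨u, hu, hmin⟩ := (isCompact_sphere (0 : Vec n) 1).exists_isMinOn h
      (seminorm_continuous N).continuousOn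
    have hu0 : 0 < N u := by
      refine lt_of_le_of_ne (apply_nonneg _ _) fun h0 => ?_
      have := hN u h0.symm
      simp [this] at hu
    refine ⟨(N u)⁻¹, inv_pos.2 hu0, fun v => ?_⟩
    rcases eq_or_ne v 0 with rfl | hv
    · simp
    · have hv' : 0 < ‖v‖ := norm_pos_iff.2 hv
      have hm : ‖v‖⁻¹ • v ∈ Metric.sphere (0 : Vec n) 1 := by
        simp [norm_smul, inv_mul_cancel₀ hv'.ne']
      have := hmin hm
      simp only [mem_ofPred_eq, map_smul_eq_mul, norm_inv, norm_norm] at this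
      rw [inv_mul_eq_div, le_div_iff₀ hu0]
      rw [inv_mul_eq_div, le_div_iff₀ hv'] at this
      linarith

lemma bddAbove_dualNorm (hN : ∀ v, N v = 0 → v = 0) (ζ : Vec n) :
    BddAbove ((fun v => inner ℝ ζ v) '' {v | N v ≤ 1}) := by
  obtain ⟨c, hc, h⟩ := norm_le_mul_seminorm hN
  refine ⟨‖ζ‖ * c, ?_⟩
  rintro _ ⟨v, hv, rfl⟩
  refine (real_inner_le_norm _ _).trans ?_
  gcongr
  exact (h v).trans (mul_le_of_le_one_right hc.le hv)

lemma inner_le_dualNorm (hN : ∀ v, N v = 0 → v = 0) (ζ v : Vec n) :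
    inner ℝ ζ v ≤ dualNorm N ζ * N v := by
  rcases eq_or_ne v 0 with rfl | hv
  · simp
  have hv' : 0 < N v := lt_of_le_of_ne (apply_nonneg _ _) fun h => hv (hN v h.symm)
  have : inner ℝ ζ ((N v)⁻¹ • v) ≤ dualNorm N ζ := by
    refine le_csSup (bddAbove_dualNorm hN ζ) ⟨_, ?_, rfl⟩
    simp [map_smul_eq_mul, abs_of_pos hv', inv_mul_cancel₀ hv'.ne']
  rwa [real_inner_smul_right, inv_mul_eq_div, div_le_iff₀ hv'] at this

lemma dualNorm_le {ζ : Vec n} {c : ℝ} (h : ∀ v, N v ≤ 1 → inner ℝ ζ v ≤ c) :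
    dualNorm N ζ ≤ c := by
  refine csSup_le ⟨_, 0, by simp, rfl⟩ ?_
  rintro _ ⟨v, hv, rfl⟩
  exact h v hv

lemma dualNorm_nonneg (hN : ∀ v, N v = 0 → v = 0) (ζ : Vec n) : 0 ≤ dualNorm N ζ :=
  le_csSup (bddAbove_dualNorm hN ζ) ⟨0, by simp, by simp⟩

lemma inner_le_dualNorm_of_le_one (hN : ∀ v, N v = 0 → v = 0) (ζ : Vec n) {v : Vec n}
    (hv : N v ≤ 1) : inner ℝ ζ v ≤ dualNorm N ζ :=
  le_csSup (bddAbove_dualNorm hN ζ) ⟨v, hv, rfl⟩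

lemma dualNorm_add_le (hN : ∀ v, N v = 0 → v = 0) (ζ η : Vec n) :
    dualNorm N (ζ + η) ≤ dualNorm N ζ + dualNorm N η :=
  dualNorm_le fun v hv => by
    rw [inner_add_left]
    exact add_le_add (inner_le_dualNorm_of_le_one hN _ hv) (inner_le_dualNorm_of_le_one hN _ hv)

lemma dualNorm_neg (hN : ∀ v, N v = 0 → v = 0) (ζ : Vec n) :
    dualNorm N (-ζ) = dualNorm N ζ := by
  have key : ∀ ζ, dualNorm N (-ζ) ≤ dualNorm N ζ := fun ζ => dualNorm_le fun v hv => by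
    rw [inner_neg_left, ← inner_neg_right]
    exact inner_le_dualNorm_of_le_one hN _ (by rwa [map_neg_eq_map])
  exact le_antisymm (key ζ) (by simpa using key (-ζ))

lemma dualNorm_smul_le (hN : ∀ v, N v = 0 → v = 0) (c : ℝ) (ζ : Vec n) :
    dualNorm N (c • ζ) ≤ |c| * dualNorm N ζ :=
  dualNorm_le fun v hv => by
    rw [real_inner_smul_left]
    rcases le_total 0 c with hc | hc
    · rw [abs_of_nonneg hc]
      exact mul_le_mul_of_nonneg_left (inner_le_dualNorm_of_le_one hN _ hv) hc
    · rw [abs_of_nonpos hc]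
      have := inner_le_dualNorm_of_le_one hN ζ (v := -v) (by rwa [map_neg_eq_map])
      rw [inner_neg_right] at this
      nlinarith

lemma abs_inner_le_dualNorm (hN : ∀ v, N v = 0 → v = 0) (ζ v : Vec n) :
    |inner ℝ ζ v| ≤ dualNorm N ζ * N v := by
  refine abs_le'.2 ⟨inner_le_dualNorm hN _ _, ?_⟩
  rw [← inner_neg_right]
  simpa using inner_le_dualNorm hN ζ (-v)

lemma dualNorm_continuous (hN : ∀ v, N v = 0 → v = 0) : Continuous (dualNorm N) := by
  obtain ⟨c, hc, h⟩ := norm_le_mul_seminorm hN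
  refine continuous_of_le_mul_norm (dualNorm_add_le hN) (C := c) fun ζ =>
    dualNorm_le fun v hv => ?_
  refine (real_inner_le_norm _ _).trans ?_
  rw [mul_comm]
  gcongr
  exact (h v).trans (mul_le_of_le_one_right hc.le hv)

end Norms

end OVSMD

namespace OVSMD

/-! ### Regularizers: compactness, the mirror map, and deterministic regret bounds -/

namespace DistGen

variable {n : ℕ} {S : Set (Vec n)} (D : DistGen S)

/-- The distance-generating function scaled by `1 / (2 D²)`, so that its range has length `1 / 2`. -/
noncomputable def reg (w : Vec n) : ℝ := D.fn w / (2 * D.diam ^ 2)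

/-- Strong convexity forces growth. If w lies at distance T > 1 from v, the point of the segment at
distance 1 from v has value at most B - α(T - 1)/2, while `fn` is bounded below on the part of `S`
near v. Hence T is bounded. -/
lemma isBounded (D : DistGen S) (hS : IsClosed S) (hc : Convex ℝ S) (hne : S.Nonempty) :
    Bornology.IsBounded S := by
  obtain ⟨v, hv⟩ := hne
  obtain ⟨c, hc0, hcN⟩ := norm_le_mul_seminorm D.definite
  obtain ⟨B, hB⟩ := D.bddAbove
  have hK : IsCompact (S ∩ {w | D.N (w - v) ≤ 1}) := by
    refine Metric.isCompact_of_isClosed_isBounded (hS.inter (isClosed_le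
      ((seminorm_continuous D.N).comp (by fun_prop)) continuous_const)) ?_
    refine (Metric.isBounded_closedBall (x := v) (r := c)).subset fun w hw => ?_
    rw [Metric.mem_closedBall, dist_eq_norm]
    exact (hcN _).trans (mul_le_of_le_one_right hc0.le hw.2)
  obtain ⟨L, hL⟩ := hK.bddBelow_image (D.continuousOn.mono inter_subset_left)
  have hLw : ∀ w ∈ S, D.N (w - v) ≤ 1 → L ≤ D.fn w := fun w hw h => hL ⟨w, ⟨hw, h⟩, rfl⟩
  have hLv : L ≤ D.fn v := hLw v hv (by simp)
  have hBv : D.fn v ≤ B := hB ⟨v, hv, rfl⟩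
  set R := max 1 (1 + 2 * (B - L) / D.α) with hR
  have hα := D.α_pos
  have hbound : ∀ w ∈ S, D.N (w - v) ≤ R := by
    intro w hw
    by_contra! hlt
    set T := D.N (w - v) with hT
    have hT1 : 1 < T := (le_max_left _ _).trans_lt hlt
    have hT2 : 1 + 2 * (B - L) / D.α < T := (le_max_right _ _).trans_lt hlt
    have hT0 : 0 < T := by linarith
    have hb : 0 ≤ 1 - T⁻¹ := by
      have := inv_le_one_of_one_le₀ hT1.le
      linarith
    have hsc := D.strongConvex w hw v hv T⁻¹ (1 - T⁻¹) (by positivity) hb (by ring)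
    have hmem : T⁻¹ • w + (1 - T⁻¹) • v ∈ S := hc hw hv (by positivity) hb (by ring)
    have hN1 : D.N (T⁻¹ • w + (1 - T⁻¹) • v - v) ≤ 1 := by
      have : T⁻¹ • w + (1 - T⁻¹) • v - v = T⁻¹ • (w - v) := by module
      rw [this, map_smul_eq_mul, ← hT, Real.norm_eq_abs, abs_of_pos (by positivity),
        inv_mul_cancel₀ hT0.ne']
    have h1 := hLw _ hmem hN1
    have hBw : D.fn w ≤ B := hB ⟨w, hw, rfl⟩
    rw [← hT] at hsc
    have h2 : D.α / 2 * (T⁻¹ * (1 - T⁻¹)) * T ^ 2 = D.α / 2 * (T - 1) := by field_simp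
    have h3 : T⁻¹ * D.fn w + (1 - T⁻¹) * D.fn v ≤ B := by
      have e1 : T⁻¹ * D.fn w ≤ T⁻¹ * B := by gcongr
      have e2 : (1 - T⁻¹) * D.fn v ≤ (1 - T⁻¹) * B := by gcongr
      linarith
    have h4 : 2 * (B - L) / D.α < T - 1 := by linarith
    rw [div_lt_iff₀ hα] at h4
    linarith
  refine (Metric.isBounded_closedBall (x := v) (r := c * R)).subset fun w hw => ?_
  rw [Metric.mem_closedBall, dist_eq_norm]
  exact (hcN _).trans (by gcongr; exact hbound w hw)

lemma isCompact (D : DistGen S) (hS : IsClosed S) (hc : Convex ℝ S) (hne : S.Nonempty) : IsCompact S :=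
  Metric.isCompact_of_isClosed_isBounded hS (D.isBounded hS hc hne)

lemma bddBelow (hS : IsClosed S) (hc : Convex ℝ S) (hne : S.Nonempty) :
    BddBelow (D.fn '' S) :=
  (D.isCompact hS hc hne).bddBelow_image D.continuousOn

lemma osc_nonneg (hS : IsClosed S) (hc : Convex ℝ S) {v w : Vec n} (hv : v ∈ S) (hw : w ∈ S) :
    D.fn w - D.fn v ≤ sSup (D.fn '' S) - sInf (D.fn '' S) :=
  sub_le_sub (le_csSup D.bddAbove ⟨w, hw, rfl⟩) (csInf_le (D.bddBelow hS hc ⟨v, hv⟩) ⟨v, hv, rfl⟩)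

lemma sub_le_diam_sq (hS : IsClosed S) (hc : Convex ℝ S) {v w : Vec n} (hv : v ∈ S) (hw : w ∈ S) :
    D.fn w - D.fn v ≤ D.diam ^ 2 := by
  have h0 := D.osc_nonneg hS hc hv hv
  rw [diam, Real.sq_sqrt (by linarith)]
  exact D.osc_nonneg hS hc hv hw

/-- Strong convexity at the midpoint: α/8 times the squared distance is at most the mean of the two
end values minus the middle value, hence at most D². -/
lemma seminorm_sq_le (hS : IsClosed S) (hc : Convex ℝ S) {v w : Vec n} (hv : v ∈ S)
    (hw : w ∈ S) : D.N (v - w) ^ 2 ≤ 8 * D.diam ^ 2 / D.α := by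
  have hsc := D.strongConvex v hv w hw (1 / 2) (1 / 2) (by norm_num) (by norm_num) (by norm_num)
  have hm : ((1 / 2 : ℝ) • v + (1 / 2 : ℝ) • w) ∈ S :=
    hc hv hw (by norm_num) (by norm_num) (by norm_num)
  have h1 := D.sub_le_diam_sq hS hc hm hv
  have h2 := D.sub_le_diam_sq hS hc hm hw
  rw [le_div_iff₀ D.α_pos]
  linarith

lemma diam_pos (hS : IsClosed S) (hc : Convex ℝ S) (hn : S.Nontrivial) : 0 < D.diam := by
  obtain ⟨v, hv, w, hw, hvw⟩ := hn
  refine lt_of_le_of_ne (Real.sqrt_nonneg _) fun h => hvw ?_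
  have := D.seminorm_sq_le hS hc hv hw
  rw [show D.diam = 0 from h.symm] at this
  have h0 : D.N (v - w) ^ 2 = 0 := le_antisymm (by simpa using this) (sq_nonneg _)
  exact sub_eq_zero.1 (D.definite _ (pow_eq_zero_iff two_ne_zero |>.1 h0))

lemma reg_sub_le (hS : IsClosed S) (hc : Convex ℝ S) (hn : S.Nontrivial) {v w : Vec n}
    (hv : v ∈ S) (hw : w ∈ S) : D.reg w - D.reg v ≤ 1 / 2 := by
  have hD := D.diam_pos hS hc hn
  rw [reg, reg, ← sub_div, div_le_iff₀ (by positivity)]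
  linarith [D.sub_le_diam_sq hS hc hv hw]

/-- The modulus of strong convexity of `reg`. -/
noncomputable def modulus : ℝ := D.α / (2 * D.diam ^ 2)

lemma modulus_pos (hD : 0 < D.diam) : 0 < D.modulus := by
  have := D.α_pos
  unfold modulus
  positivity

lemma reg_strongConvex (hD : 0 < D.diam) {v w : Vec n} (hv : v ∈ S) (hw : w ∈ S) {a b : ℝ}
    (ha : 0 ≤ a) (hb : 0 ≤ b) (hab : a + b = 1) :
    D.reg (a • v + b • w) ≤ a * D.reg v + b * D.reg w
      - D.modulus / 2 * (a * b) * D.N (v - w) ^ 2 := by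
  have h := D.strongConvex v hv w hw a b ha hb hab
  unfold reg modulus
  rw [div_le_iff₀ (by positivity)]
  refine h.trans (le_of_eq ?_)
  field_simp

/-- `v` minimizes `⟨η, w⟩ + reg w` over `S`. -/
def IsArgmin (η v : Vec n) : Prop :=
  v ∈ S ∧ ∀ w ∈ S, inner ℝ η v + D.reg v ≤ inner ℝ η w + D.reg w

variable {D}

/-- Compare v with (1 - b)v + bw, divide by b and let b tend to 0. No differentiability is involved.
-/
lemma IsArgmin.growth (hc : Convex ℝ S) (hD : 0 < D.diam) {η v w : Vec n}
    (hv : D.IsArgmin η v) (hw : w ∈ S) :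
    inner ℝ η v + D.reg v + D.modulus / 2 * D.N (v - w) ^ 2 ≤ inner ℝ η w + D.reg w := by
  have key : ∀ b : ℝ, 0 < b → b < 1 → D.modulus / 2 * D.N (v - w) ^ 2 * (1 - b) ≤
      (inner ℝ η w + D.reg w) - (inner ℝ η v + D.reg v) := by
    intro b hb0 hb1
    have h1 := hv.2 _ (hc hv.1 hw (by linarith : 0 ≤ 1 - b) hb0.le (by ring))
    have h2 := D.reg_strongConvex hD hv.1 hw (by linarith : 0 ≤ 1 - b) hb0.le (by ring)
    rw [inner_add_right, real_inner_smul_right, real_inner_smul_right] at h1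
    have h3 : b * (D.modulus / 2 * D.N (v - w) ^ 2 * (1 - b)) ≤
        b * ((inner ℝ η w + D.reg w) - (inner ℝ η v + D.reg v)) := by linarith
    exact le_of_mul_le_mul_left h3 hb0
  set c := D.modulus / 2 * D.N (v - w) ^ 2
  set e := (inner ℝ η w + D.reg w) - (inner ℝ η v + D.reg v) with he
  suffices c ≤ e by linarith
  have ht : Filter.Tendsto (fun b : ℝ => c * (1 - b)) (nhdsWithin 0 (Ioi 0)) (nhds (c * (1 - 0))) :=
    (Continuous.tendsto (by fun_prop) 0).mono_left nhdsWithin_le_nhds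
  rw [sub_zero, mul_one] at ht
  refine le_of_tendsto ht ?_
  filter_upwards [Ioo_mem_nhdsGT (one_pos : (0 : ℝ) < 1)] with b hb
  exact key b hb.1 hb.2

/-- Adding the growth inequalities of the two minimizers gives strong monotonicity. The resulting
Lipschitz dependence of the minimizer on η yields its uniqueness and the continuity of `mirror`. -/
lemma IsArgmin.seminorm_le (hc : Convex ℝ S) (hD : 0 < D.diam) {η η' v v' : Vec n}
    (hv : D.IsArgmin η v) (hv' : D.IsArgmin η' v') :
    D.modulus * D.N (v - v') ≤ dualNorm D.N (η - η') := by
  have h1 := hv.growth hc hD hv'.1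
  have h2 := hv'.growth hc hD hv.1
  rw [map_sub_rev D.N v' v] at h2
  have h3 : inner ℝ (η - η') (v' - v) ≤ dualNorm D.N (η - η') * D.N (v' - v) :=
    inner_le_dualNorm D.definite _ _
  rw [map_sub_rev D.N v' v, inner_sub_left, inner_sub_right, inner_sub_right] at h3
  rcases (apply_nonneg D.N (v - v')).eq_or_lt with h0 | h0
  · rw [← h0, mul_zero]
    exact dualNorm_nonneg D.definite _
  · refine le_of_mul_le_mul_right ?_ h0
    nlinarith

lemma IsArgmin.unique (hc : Convex ℝ S) (hD : 0 < D.diam) {η v v' : Vec n}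
    (hv : D.IsArgmin η v) (hv' : D.IsArgmin η v') : v = v' := by
  have h := hv.seminorm_le hc hD hv'
  have h0 : dualNorm D.N (η - η) ≤ 0 := dualNorm_le fun v _ => by simp
  have := D.modulus_pos hD
  have h1 : D.N (v - v') ≤ 0 := by
    by_contra! h2
    have := mul_pos this h2
    linarith
  exact sub_eq_zero.1 (D.definite _ (le_antisymm h1 (apply_nonneg _ _)))

variable (D)

lemma exists_isArgmin (hS : IsClosed S) (hc : Convex ℝ S) (hne : S.Nonempty) (η : Vec n) :
    ∃ v, D.IsArgmin η v := by
  have hcont : ContinuousOn (fun w => inner ℝ η w + D.reg w) S := by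
    refine ContinuousOn.add (by fun_prop) ?_
    unfold reg
    exact D.continuousOn.div_const _
  obtain ⟨v, hv, hmin⟩ := (D.isCompact hS hc hne).exists_isMinOn hne hcont
  exact ⟨v, hv, fun w hw => hmin hw⟩

open Classical in
/-- The minimizer of `⟨η, w⟩ + reg w` over `S`. -/
noncomputable def mirror (η : Vec n) : Vec n :=
  if h : ∃ v, D.IsArgmin η v then h.choose else 0

lemma isArgmin_mirror (hS : IsClosed S) (hc : Convex ℝ S) (hne : S.Nonempty) (η : Vec n) :
    D.IsArgmin η (D.mirror η) := by
  have h := D.exists_isArgmin hS hc hne η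
  rw [mirror, dif_pos h]
  exact h.choose_spec

lemma mirror_continuous (hS : IsClosed S) (hc : Convex ℝ S) (hn : S.Nontrivial) :
    Continuous D.mirror := by
  have hD := D.diam_pos hS hc hn
  have hσ := D.modulus_pos hD
  obtain ⟨c, hc0, hcN⟩ := norm_le_mul_seminorm D.definite
  rw [continuous_iff_continuousAt]
  intro η
  rw [ContinuousAt, tendsto_iff_dist_tendsto_zero]
  have ht : Filter.Tendsto (fun η' => c * (dualNorm D.N (η' - η) / D.modulus)) (nhds η)
      (nhds (c * (dualNorm D.N (η - η) / D.modulus))) := by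
    refine Continuous.tendsto ?_ η
    exact continuous_const.mul (((dualNorm_continuous D.definite).comp (by fun_prop)).div_const _)
  have h0 : dualNorm D.N (η - η) = 0 :=
    le_antisymm (dualNorm_le fun v _ => by simp) (dualNorm_nonneg D.definite _)
  rw [h0, zero_div, mul_zero] at ht
  refine squeeze_zero (fun _ => dist_nonneg) (fun η' => ?_) ht
  rw [dist_eq_norm]
  refine (hcN _).trans ?_
  gcongr
  rw [le_div_iff₀ hσ, mul_comm]
  exact (D.isArgmin_mirror hS hc hn.nonempty η').seminorm_le hc hD
    (D.isArgmin_mirror hS hc hn.nonempty η)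

variable {D} in
-- Young's inequality with weights chosen so that the second term is exactly the quadratic gain in
-- `IsArgmin.growth`; note D²/α = 1/(2 · modulus).
lemma inner_le_growth (hD : 0 < D.diam) (ζ v : Vec n) :
    inner ℝ ζ v ≤ D.diam ^ 2 / D.α * dualNorm D.N ζ ^ 2 + D.modulus / 2 * D.N v ^ 2 := by
  have hα := D.α_pos
  refine (inner_le_dualNorm D.definite ζ v).trans ?_
  have : D.diam ^ 2 / D.α = 1 / (2 * D.modulus) := by
    unfold modulus
    field_simp
  rw [this]
  have hσ := D.modulus_pos hD
  have h := sq_nonneg (dualNorm D.N ζ / D.modulus - D.N v)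
  have h2 : 1 / (2 * D.modulus) * dualNorm D.N ζ ^ 2 + D.modulus / 2 * D.N v ^ 2 -
      dualNorm D.N ζ * D.N v = D.modulus / 2 * (dualNorm D.N ζ / D.modulus - D.N v) ^ 2 := by
    field_simp
    ring
  have h3 : 0 ≤ D.modulus / 2 * (dualNorm D.N ζ / D.modulus - D.N v) ^ 2 := by positivity
  linarith

/-- The regret bound of dual averaging. -/
lemma dualAveraging_regret (hS : IsClosed S) (hc : Convex ℝ S) (hn : S.Nontrivial)
    (ζ : ℕ → Vec n) (t : ℕ) {w : Vec n} (hw : w ∈ S) :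
    ∑ s ∈ Finset.range t, inner ℝ (ζ s) (D.mirror (∑ r ∈ Finset.range s, ζ r) - w) ≤
      1 / 2 + ∑ s ∈ Finset.range t, D.diam ^ 2 / D.α * dualNorm D.N (ζ s) ^ 2 := by
  have hD := D.diam_pos hS hc hn
  set R := fun s => D.mirror (∑ r ∈ Finset.range s, ζ r) with hR
  have hA : ∀ s, D.IsArgmin (∑ r ∈ Finset.range s, ζ r) (R s) :=
    fun s => D.isArgmin_mirror hS hc hn.nonempty _
  -- The potential is the minimum value of the accumulated linear cost plus `reg`. Each round raises
  -- it by at least ⟨ζ_t, R_t⟩ minus the Young term, because growth at R_t absorbs the move to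
  -- R_{t+1}.
  have key : ∀ t, D.reg (R 0) + ∑ s ∈ Finset.range t,
      (inner ℝ (ζ s) (R s) - D.diam ^ 2 / D.α * dualNorm D.N (ζ s) ^ 2) ≤
      inner ℝ (∑ r ∈ Finset.range t, ζ r) (R t) + D.reg (R t) := by
    intro t
    induction t with
    | zero => simp
    | succ t ih =>
      have h1 := (hA t).growth hc hD (hA (t + 1)).1
      have h2 := inner_le_growth hD (ζ t) (R t - R (t + 1))
      rw [Finset.sum_range_succ, Finset.sum_range_succ, inner_add_left]
      rw [inner_sub_right] at h2
      linarith
  have h1 := key t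
  have h2 := (hA t).2 w hw
  have h3 := D.reg_sub_le hS hc hn (hA 0).1 hw
  simp only [inner_sub_right, Finset.sum_sub_distrib] at h1 ⊢
  rw [← sum_inner]
  linarith

variable {D} in
lemma IsArgmin.mem_subdiffDomain (hD : 0 < D.diam) {η v : Vec n} (hv : D.IsArgmin η v) :
    v ∈ subdiffDomain S D.fn := by
  refine ⟨hv.1, (-(2 * D.diam ^ 2)) • η, fun w hw => ?_⟩
  have h := hv.2 w hw
  unfold reg at h
  have hp : 0 < 2 * D.diam ^ 2 := by positivity
  have h' : inner ℝ η v * (2 * D.diam ^ 2) + D.fn v ≤ inner ℝ η w * (2 * D.diam ^ 2) + D.fn w := by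
    have := mul_le_mul_of_nonneg_right h hp.le
    rwa [add_mul, add_mul, div_mul_cancel₀ _ hp.ne', div_mul_cancel₀ _ hp.ne'] at this
  rw [real_inner_smul_left, inner_sub_right]
  linarith

/-- The gradient of `reg`. -/
noncomputable def regGrad (v : Vec n) : Vec n := (1 / (2 * D.diam ^ 2)) • D.grad v

variable {D} in
lemma hasGrad_reg {v : Vec n} (hv : v ∈ subdiffDomain S D.fn) :
    HasGradientWithinAt D.reg (D.regGrad v) S v := by
  have h := (D.hasGrad v hv).hasFDerivWithinAt.const_mul (1 / (2 * D.diam ^ 2))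
  rw [hasGradientWithinAt_iff_hasFDerivWithinAt]
  have h1 : D.reg = fun w => 1 / (2 * D.diam ^ 2) * D.fn w := by
    ext w
    unfold reg
    ring
  rw [h1, regGrad, map_smul]
  exact h

variable {D} in
lemma IsArgmin.firstOrder (hc : Convex ℝ S) (hD : 0 < D.diam) {η v w : Vec n}
    (hv : D.IsArgmin η v) (hw : w ∈ S) : 0 ≤ inner ℝ (η + D.regGrad v) (w - v) := by
  have hg := (hasGrad_reg (hv.mem_subdiffDomain hD)).hasFDerivWithinAt
  have hf : HasFDerivWithinAt (fun w => inner ℝ η w + D.reg w)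
      (innerSL ℝ η + (InnerProductSpace.toDual ℝ (Vec n)) (D.regGrad v)) S v :=
    ((innerSL ℝ η).hasFDerivWithinAt (x := v) (s := S)).add hg
  have hm : IsLocalMinOn (fun w => inner ℝ η w + D.reg w) S v :=
    IsMinOn.localize fun w hw => hv.2 w hw
  have := hm.hasFDerivWithinAt_nonneg hf
    (sub_mem_posTangentConeAt_of_segment_subset (hc.segment_subset hv.1 hw))
  rw [inner_add_left]
  simpa using this

variable {D} in
-- The gradient inequality makes v a minimizer of `reg` tilted by its own gradient, so the quadratic
-- term comes for free from `IsArgmin.growth`.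
lemma reg_ge_gradient (hc : Convex ℝ S) (hD : 0 < D.diam) {v w : Vec n}
    (hv : v ∈ subdiffDomain S D.fn) (hw : w ∈ S) :
    D.reg v + inner ℝ (D.regGrad v) (w - v) + D.modulus / 2 * D.N (v - w) ^ 2 ≤ D.reg w := by
  have hA : D.IsArgmin (-D.regGrad v) v := by
    refine ⟨hv.1, fun w hw => ?_⟩
    have hline : HasDerivWithinAt (fun b : ℝ => v + b • (w - v)) (w - v) (Icc 0 1) 0 := by
      simpa using (((hasDerivAt_id (0 : ℝ)).smul_const (w - v)).const_add v).hasDerivWithinAt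
    have hmaps : MapsTo (fun b : ℝ => v + b • (w - v)) (Icc 0 1) S := fun b hb =>
      hc.add_smul_sub_mem hv.1 hw hb
    have hg : HasFDerivWithinAt D.reg ((InnerProductSpace.toDual ℝ (Vec n)) (D.regGrad v)) S
        (v + (0 : ℝ) • (w - v)) := by
      rw [zero_smul, add_zero]
      exact (hasGrad_reg hv).hasFDerivWithinAt
    have hd := hg.comp_hasDerivWithinAt (0 : ℝ) hline hmaps
    -- The chord minus the function along the segment, up to a constant: by convexity it is smallest
    -- at b = 0, so its right derivative there is nonnegative.
    have hd2 : HasDerivWithinAt (fun b : ℝ => b * (D.reg w - D.reg v) - D.reg (v + b • (w - v)))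
        (1 * (D.reg w - D.reg v) - inner ℝ (D.regGrad v) (w - v)) (Icc 0 1) 0 :=
      (((hasDerivAt_id (0 : ℝ)).mul_const _).hasDerivWithinAt).sub hd
    have hm : IsLocalMinOn
        (fun b : ℝ => b * (D.reg w - D.reg v) - D.reg (v + b • (w - v))) (Icc 0 1) 0 := by
      refine IsMinOn.localize fun b hb => ?_
      have h := D.reg_strongConvex hD hv.1 hw (sub_nonneg.2 hb.2) hb.1 (by ring)
      have e : (1 - b) • v + b • w = v + b • (w - v) := by module
      have h2 : 0 ≤ D.modulus / 2 * ((1 - b) * b) * D.N (v - w) ^ 2 := by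
        have := D.modulus_pos hD
        have h3 := sub_nonneg.2 hb.2
        have h4 := hb.1
        positivity
      rw [e] at h
      simp only [mem_ofPred_eq, zero_mul, zero_smul, add_zero]
      linarith
    have := hm.hasFDerivWithinAt_nonneg hd2.hasFDerivWithinAt (y := 1)
      (mem_posTangentConeAt_of_segment_subset (by rw [zero_add, segment_eq_Icc zero_le_one]))
    simp only [ContinuousLinearMap.toSpanSingleton_apply, one_smul, inner_sub_right] at this
    simp only [inner_neg_left]
    linarith
  have h := hA.growth hc hD hw
  rw [inner_sub_right]
  simp only [inner_neg_left] at h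
  linarith

/-- The Bregman divergence of `reg`. -/
noncomputable def breg (v w : Vec n) : ℝ :=
  D.reg w - D.reg v - inner ℝ (D.regGrad v) (w - v)

variable {D} in
-- The three-point inequality: optimality of v' tested at w, combined with strong convexity between
-- v and v', whose quadratic term absorbs ⟨ζ, v - v'⟩.
lemma mirrorDescent_step (hc : Convex ℝ S) (hD : 0 < D.diam) {v v' w ζ : Vec n}
    (hv : v ∈ subdiffDomain S D.fn) (hv' : D.IsArgmin (ζ - D.regGrad v) v') (hw : w ∈ S) :
    inner ℝ ζ (v - w) ≤
      D.breg v w - D.breg v' w + D.diam ^ 2 / D.α * dualNorm D.N ζ ^ 2 := by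
  have h1 := hv'.firstOrder hc hD hw
  have h2 := reg_ge_gradient hc hD hv hv'.1
  have h3 := inner_le_growth hD ζ (v - v')
  unfold breg
  simp only [inner_sub_right, inner_sub_left, inner_add_left] at *
  linarith

/-- The regret bound of mirror descent. -/
lemma mirrorDescent_regret (hS : IsClosed S) (hc : Convex ℝ S) (hn : S.Nontrivial)
    {v ζ : ℕ → Vec n} (h0 : D.IsArgmin 0 (v 0))
    (hstep : ∀ s, D.IsArgmin (ζ s - D.regGrad (v s)) (v (s + 1))) (t : ℕ) {w : Vec n}
    (hw : w ∈ S) :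
    ∑ s ∈ Finset.range t, inner ℝ (ζ s) (v s - w) ≤
      1 / 2 + ∑ s ∈ Finset.range t, D.diam ^ 2 / D.α * dualNorm D.N (ζ s) ^ 2 := by
  have hD := D.diam_pos hS hc hn
  have hdom : ∀ s, v s ∈ subdiffDomain S D.fn := by
    intro s
    cases s with
    | zero => exact h0.mem_subdiffDomain hD
    | succ s => exact (hstep s).mem_subdiffDomain hD
  have key : ∀ t, ∑ s ∈ Finset.range t, inner ℝ (ζ s) (v s - w) ≤
      D.breg (v 0) w - D.breg (v t) w +
        ∑ s ∈ Finset.range t, D.diam ^ 2 / D.α * dualNorm D.N (ζ s) ^ 2 := by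
    intro t
    induction t with
    | zero => simp
    | succ t ih =>
      rw [Finset.sum_range_succ, Finset.sum_range_succ]
      have := mirrorDescent_step hc hD (hdom t) (hstep t) hw
      linarith
  have h1 := key t
  have h2 : 0 ≤ D.breg (v t) w := by
    have := reg_ge_gradient hc hD (hdom t) hw
    have h3 : 0 ≤ D.modulus / 2 * D.N (v t - w) ^ 2 := by
      have := D.modulus_pos hD
      positivity
    unfold breg
    linarith
  -- The start minimizes `reg`, so its gradient term has the favourable sign and only the
  -- oscillation of `reg` remains.
  have h3 : D.breg (v 0) w ≤ 1 / 2 := by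
    have h4 := h0.firstOrder hc hD hw
    have h5 := D.reg_sub_le hS hc hn h0.1 hw
    rw [zero_add] at h4
    unfold breg
    linarith
  linarith

end DistGen

end OVSMD

namespace OVSMD

/-! ### Exponential moments and Markov's inequality -/

section Exponential

lemma exp_le_add_exp_sq (x : ℝ) : Real.exp x ≤ x + Real.exp (x ^ 2) := by
  rcases le_or_gt |x| 1 with h | h
  · have h1 := (abs_le.1 (Real.abs_exp_sub_one_sub_id_le h)).2
    have h2 := Real.add_one_le_exp (x ^ 2)
    linarith
  · rcases lt_abs.1 h with h | h
    · have : Real.exp x ≤ Real.exp (x ^ 2) := Real.exp_le_exp.2 (by nlinarith)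
      linarith
    · have h1 : Real.exp x ≤ 1 := Real.exp_le_one_iff.2 (by linarith)
      have h2 := Real.add_one_le_exp (x ^ 2)
      nlinarith

/-- The chord of exp between 0 and u - 1, multiplied by exp p. Taking expectations, E exp u ≤ e
gives E exp(pu) ≤ exp p, with an explicit integrable majorant. -/
lemma exp_mul_le {p : ℝ} (hp0 : 0 ≤ p) (hp1 : p ≤ 1) (u : ℝ) :
    Real.exp (p * u) ≤ Real.exp p * ((1 - p) + p * (Real.exp (-1) * Real.exp u)) := by
  have h := convexOn_exp.2 (mem_univ (0 : ℝ)) (mem_univ (u - 1)) (sub_nonneg.2 hp1) hp0 (by ring)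
  simp only [smul_eq_mul, mul_zero, zero_add, Real.exp_zero, mul_one] at h
  rw [← Real.exp_add, show -1 + u = u - 1 by ring]
  calc Real.exp (p * u) = Real.exp p * Real.exp (p * (u - 1)) := by
        rw [← Real.exp_add]; ring_nf
    _ ≤ _ := by gcongr

variable {E : Type*} [MeasurableSpace E] {μ : Measure E}

lemma integrable_of_lintegral_ofReal_le {W : E → ℝ} (hW : Measurable W) (h0 : ∀ e, 0 ≤ W e) {c : ℝ}
    (hc : 0 ≤ c) (h : ∫⁻ e, ENNReal.ofReal (W e) ∂μ ≤ ENNReal.ofReal c) :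
    Integrable W μ ∧ ∫ e, W e ∂μ ≤ c := by
  have hi : Integrable W μ := by
    refine ⟨hW.aestronglyMeasurable, ?_⟩
    rw [hasFiniteIntegral_iff_ofReal (ae_of_all _ h0)]
    exact h.trans_lt ENNReal.ofReal_lt_top
  refine ⟨hi, ?_⟩
  rwa [← ofReal_integral_eq_lintegral_ofReal hi (ae_of_all _ h0),
    ENNReal.ofReal_le_ofReal_iff hc] at h

lemma lintegral_ofReal_le_of_le {f g : E → ℝ} (hg : Integrable g μ) (h0 : ∀ e, 0 ≤ f e)
    (hfg : ∀ e, f e ≤ g e) {c : ℝ} (hc : ∫ e, g e ∂μ ≤ c) :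
    ∫⁻ e, ENNReal.ofReal (f e) ∂μ ≤ ENNReal.ofReal c := by
  calc ∫⁻ e, ENNReal.ofReal (f e) ∂μ ≤ ∫⁻ e, ENNReal.ofReal (g e) ∂μ :=
        lintegral_mono fun e => ENNReal.ofReal_le_ofReal (hfg e)
    _ = ENNReal.ofReal (∫ e, g e ∂μ) :=
        (ofReal_integral_eq_lintegral_ofReal hg (ae_of_all _ fun e => (h0 e).trans (hfg e))).symm
    _ ≤ _ := ENNReal.ofReal_le_ofReal hc

/-- A centred random variable with `E exp (X² / σ²) ≤ e` is sub-Gaussian. -/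
lemma lintegral_exp_mul_le [IsProbabilityMeasure μ] {X : E → ℝ} (hX : Measurable X)
    (hint : Integrable X μ) (hmean : ∫ e, X e ∂μ = 0) {σ : ℝ} (hσ : 0 < σ)
    (htail : ∫⁻ e, ENNReal.ofReal (Real.exp (X e ^ 2 / σ ^ 2)) ∂μ ≤ ENNReal.ofReal (Real.exp 1))
    (θ : ℝ) :
    ∫⁻ e, ENNReal.ofReal (Real.exp (θ * X e)) ∂μ ≤ ENNReal.ofReal (Real.exp (θ ^ 2 * σ ^ 2)) := by
  set W : E → ℝ := fun e => Real.exp (X e ^ 2 / σ ^ 2) with hWdef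
  obtain ⟨hWi, hWe⟩ := integrable_of_lintegral_ofReal_le (W := W) (by fun_prop)
    (fun e => (Real.exp_pos _).le) (Real.exp_pos 1).le htail
  have hW1 : Real.exp (-1) * ∫ e, W e ∂μ ≤ 1 := by
    calc Real.exp (-1) * ∫ e, W e ∂μ ≤ Real.exp (-1) * Real.exp 1 := by gcongr
      _ = 1 := by rw [← Real.exp_add]; simp
  have hgi : ∀ p : ℝ, Integrable (fun e => (1 - p) + p * (Real.exp (-1) * W e)) μ := fun p =>
    (integrable_const _).add ((hWi.const_mul _).const_mul _)
  have hgint : ∀ p : ℝ, 0 ≤ p → ∫ e, ((1 - p) + p * (Real.exp (-1) * W e)) ∂μ ≤ 1 := by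
    intro p hp
    rw [integral_add (integrable_const _) ((hWi.const_mul _).const_mul _), integral_const_mul,
      integral_const_mul]
    simp only [integral_const, probReal_univ, one_smul]
    nlinarith
  set q := θ ^ 2 * σ ^ 2 with hq
  have hq0 : 0 ≤ q := by positivity
  have hθX : ∀ e, (θ * X e) ^ 2 = q * (X e ^ 2 / σ ^ 2) := fun e => by
    rw [hq]; field_simp
  -- For q ≤ 1 use exp x ≤ x + exp(x²): the linear term has mean zero, and the other is a power q ≤
  -- 1 of `W`. For q ≥ 1 use θX ≤ q/2 + X²/(2σ²), which costs exp(q/2 + 1/2) ≤ exp q.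
  rcases le_total q 1 with h1 | h1
  · refine lintegral_ofReal_le_of_le
      (g := fun e => θ * X e + Real.exp q * ((1 - q) + q * (Real.exp (-1) * W e)))
      ((hint.const_mul _).add ((hgi q).const_mul _)) (fun e => (Real.exp_pos _).le)
      (fun e => ?_) ?_
    · refine (exp_le_add_exp_sq _).trans ?_
      rw [hθX]
      gcongr
      exact exp_mul_le hq0 h1 _
    · rw [integral_add (hint.const_mul _) ((hgi q).const_mul _), integral_const_mul,
        integral_const_mul, hmean, mul_zero, zero_add]
      exact mul_le_of_le_one_right (Real.exp_pos _).le (hgint q hq0)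
  · refine lintegral_ofReal_le_of_le (g := fun e => Real.exp (q / 2) * (Real.exp (1 / 2) *
      ((1 - 1 / 2) + 1 / 2 * (Real.exp (-1) * W e))))
      (((hgi _).const_mul _).const_mul _) (fun e => (Real.exp_pos _).le) (fun e => ?_) ?_
    · have h2 : θ * X e ≤ q / 2 + 1 / 2 * (X e ^ 2 / σ ^ 2) := by
        have h3 : X e / σ * σ = X e := div_mul_cancel₀ _ hσ.ne'
        have h4 := sq_nonneg (θ * σ - X e / σ)
        have h5 : (X e / σ) ^ 2 = X e ^ 2 / σ ^ 2 := by ring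
        have h6 : θ * σ * (X e / σ) = θ * X e := by field_simp
        rw [← h5, hq]
        nlinarith
      refine (Real.exp_le_exp.2 h2).trans ?_
      rw [Real.exp_add]
      gcongr
      exact exp_mul_le (by norm_num) (by norm_num) _
    · rw [integral_const_mul, integral_const_mul, ← mul_assoc, ← Real.exp_add]
      refine (mul_le_of_le_one_right (Real.exp_pos _).le (hgint _ (by norm_num))).trans ?_
      exact Real.exp_le_exp.2 (by linarith)

/-- Markov's inequality for the exponential of a random variable. -/
lemma measure_le_of_lintegral_exp_le {Ω : Type*} [MeasurableSpace Ω] {P : Measure Ω} {Y : Ω → ℝ}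
    (hY : Measurable Y) {c : ℝ}
    (h : ∫⁻ o, ENNReal.ofReal (Real.exp (Y o)) ∂P ≤ ENNReal.ofReal (Real.exp c)) (b : ℝ) :
    P {o | b < Y o} ≤ ENNReal.ofReal (Real.exp (c - b)) := by
  have h1 := mul_meas_ge_le_lintegral (μ := P) (f := fun o => ENNReal.ofReal (Real.exp (Y o)))
    (by fun_prop) (ENNReal.ofReal (Real.exp b))
  have h2 : P {o | b < Y o} ≤
      P {o | ENNReal.ofReal (Real.exp b) ≤ ENNReal.ofReal (Real.exp (Y o))} :=
    measure_mono fun o (ho : b < Y o) => ENNReal.ofReal_le_ofReal (Real.exp_le_exp.2 ho.le)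
  have h3 : ENNReal.ofReal (Real.exp b) ≠ 0 := by
    simp [Real.exp_pos]
  rw [Real.exp_sub, ENNReal.ofReal_div_of_pos (Real.exp_pos b),
    ENNReal.le_div_iff_mul_le (Or.inl h3) (Or.inl ENNReal.ofReal_ne_top), mul_comm]
  calc _ ≤ ENNReal.ofReal (Real.exp b) *
        P {o | ENNReal.ofReal (Real.exp b) ≤ ENNReal.ofReal (Real.exp (Y o))} := by gcongr
    _ ≤ _ := h1.trans h

end Exponential

/-! ### Past-measurable processes and concentration of adapted sums -/

section Past

variable {E Ω β : Type*} [MeasurableSpace E]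

/-- The σ-algebra generated by the samples `ξ s`, `s < t`. -/
@[reducible] def past (ξ : ℕ → Ω → E) (t : ℕ) : MeasurableSpace Ω :=
  ⨆ s ∈ Iio t, MeasurableSpace.comap (ξ s) inferInstance

lemma past_le [MeasurableSpace Ω] {ξ : ℕ → Ω → E} (hξ : ∀ t, Measurable (ξ t)) (t : ℕ) :
    past ξ t ≤ (inferInstance : MeasurableSpace Ω) :=
  iSup₂_le fun s _ => (hξ s).comap_le

lemma past_mono (ξ : ℕ → Ω → E) {s t : ℕ} (h : s ≤ t) : past ξ s ≤ past ξ t :=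
  biSup_mono fun _ hr => lt_of_lt_of_le hr h

lemma measurable_past (ξ : ℕ → Ω → E) {s t : ℕ} (h : s < t) : Measurable[past ξ t] (ξ s) := by
  rw [measurable_iff_comap_le]
  exact le_iSup₂_of_le s h le_rfl

lemma measurable_past_step [MeasurableSpace β] {ξ : ℕ → Ω → E} {t : ℕ} {A : Ω → β} (hA : Measurable[past ξ t] A) {γ : Type*}
    [MeasurableSpace γ] {f : β × E → γ} (hf : Measurable f) :
    Measurable[past ξ (t + 1)] fun o => f (A o, ξ t o) :=
  hf.comp ((hA.mono (past_mono ξ t.le_succ) le_rfl).prodMk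
    (measurable_past ξ t.lt_succ_self))

variable [MeasurableSpace Ω] [MeasurableSpace β] {P : Measure Ω} {μ : Measure E} {ξ : ℕ → Ω → E}

lemma indepFun_of_past (hξ : ∀ t, Measurable (ξ t)) (hind : iIndepFun ξ P) {t : ℕ} {A : Ω → β}
    (hA : Measurable[past ξ t] A) : IndepFun A (ξ t) P := by
  rw [IndepFun_iff_Indep]
  have h := indep_iSup_of_disjoint (fun s => (hξ s).comap_le) hind.iIndep
    (S := Iio t) (T := {t}) (by simp)
  simp only [mem_singleton_iff, iSup_iSup_eq_left] at h
  exact indep_of_indep_of_le_left h (measurable_iff_comap_le.1 hA)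

variable [IsProbabilityMeasure P]

/-- The pair (B, A) is independent of ξ_t, so the joint law is a product and Tonelli's theorem
applies. This replaces conditional expectation given the past. -/
lemma lintegral_mul_le_of_past (hξ : ∀ t, Measurable (ξ t)) (hlaw : ∀ t, P.map (ξ t) = μ)
    (hind : iIndepFun ξ P) {t : ℕ} {A : Ω → β} (hA : Measurable[past ξ t] A) {B : Ω → ENNReal}
    (hB : Measurable[past ξ t] B) {f : β × E → ENNReal} (hf : Measurable f) {c : ENNReal}
    (hc : ∀ b, ∫⁻ e, f (b, e) ∂μ ≤ c) :
    ∫⁻ o, B o * f (A o, ξ t o) ∂P ≤ c * ∫⁻ o, B o ∂P := by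
  have hle := past_le hξ t
  have hA' : Measurable A := hA.mono hle le_rfl
  have hB' : Measurable B := hB.mono hle le_rfl
  have hBA : Measurable[past ξ t] fun o => (B o, A o) := hB.prodMk hA
  have hI := indepFun_of_past hξ hind hBA
  have hμ : IsProbabilityMeasure μ := hlaw 0 ▸ Measure.isProbabilityMeasure_map (hξ 0).aemeasurable
  rw [indepFun_iff_map_prod_eq_prod_map_map (hB'.prodMk hA').aemeasurable (hξ t).aemeasurable,
    hlaw t] at hI
  have hg : Measurable fun q : (ENNReal × β) × E => q.1.1 * f (q.1.2, q.2) := by fun_prop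
  calc ∫⁻ o, B o * f (A o, ξ t o) ∂P
      = ∫⁻ q, q.1.1 * f (q.1.2, q.2) ∂(P.map fun o => ((B o, A o), ξ t o)) := by
        rw [lintegral_map hg ((hB'.prodMk hA').prodMk (hξ t))]
    _ = ∫⁻ a, ∫⁻ e, a.1 * f (a.2, e) ∂μ ∂(P.map fun o => (B o, A o)) := by
        rw [hI, lintegral_prod _ hg.aemeasurable]
    _ ≤ ∫⁻ a, c * a.1 ∂(P.map fun o => (B o, A o)) := by
        refine lintegral_mono fun a => ?_
        dsimp only
        rw [lintegral_const_mul _ (by fun_prop), mul_comm]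
        gcongr
        exact hc _
    _ = ∫⁻ o, c * B o ∂P := by
        rw [lintegral_map (by fun_prop) (hB'.prodMk hA')]
    _ = _ := lintegral_const_mul _ hB'

lemma lintegral_le_of_past (hξ : ∀ t, Measurable (ξ t)) (hlaw : ∀ t, P.map (ξ t) = μ)
    (hind : iIndepFun ξ P) {t : ℕ} {A : Ω → β} (hA : Measurable[past ξ t] A)
    {f : β × E → ENNReal} (hf : Measurable f) {c : ENNReal}
    (hc : ∀ b, ∫⁻ e, f (b, e) ∂μ ≤ c) :
    ∫⁻ o, f (A o, ξ t o) ∂P ≤ c := by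
  simpa using lintegral_mul_le_of_past hξ hlaw hind hA (B := fun _ => 1)
    (@measurable_const _ _ _ (past ξ t) _) hf hc

/-- Peel off the last increment: the exponential of the earlier sum is measurable with respect to
the past and plays the role of B above. Measurability is carried along in the induction. -/
lemma lintegral_exp_sum_le (hξ : ∀ t, Measurable (ξ t)) (hlaw : ∀ t, P.map (ξ t) = μ)
    (hind : iIndepFun ξ P) {A : ℕ → Ω → β} (hA : ∀ t, Measurable[past ξ t] (A t))
    {f : ℕ → β × E → ℝ} (hf : ∀ t, Measurable (f t)) {σ : ℕ → ℝ} {θ : ℝ}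
    (hmgf : ∀ t b, ∫⁻ e, ENNReal.ofReal (Real.exp (θ * f t (b, e))) ∂μ ≤
      ENNReal.ofReal (Real.exp (θ ^ 2 * σ t ^ 2))) (t : ℕ) :
    (Measurable[past ξ t] fun o => ∑ s ∈ Finset.range t, f s (A s o, ξ s o)) ∧
    ∫⁻ o, ENNReal.ofReal (Real.exp (θ * ∑ s ∈ Finset.range t, f s (A s o, ξ s o))) ∂P ≤
      ENNReal.ofReal (Real.exp (θ ^ 2 * ∑ s ∈ Finset.range t, σ s ^ 2)) := by
  induction t with
  | zero => simp
  | succ t ih =>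
    obtain ⟨ihm, ihi⟩ := ih
    constructor
    · simp only [Finset.sum_range_succ]
      exact (ihm.mono (past_mono ξ t.le_succ) le_rfl).add (measurable_past_step (hA t) (hf t))
    · have hB : Measurable[past ξ t] fun o => ENNReal.ofReal
          (Real.exp (θ * ∑ s ∈ Finset.range t, f s (A s o, ξ s o))) :=
        (show Measurable fun x : ℝ => ENNReal.ofReal (Real.exp (θ * x)) by fun_prop).comp ihm
      have h := lintegral_mul_le_of_past hξ hlaw hind (hA t) hB
        (f := fun q => ENNReal.ofReal (Real.exp (θ * f t q))) (by fun_prop) (hmgf t)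
      simp only [Finset.sum_range_succ, mul_add, Real.exp_add]
      rw [mul_comm (Real.exp (θ ^ 2 * _)), ENNReal.ofReal_mul (Real.exp_pos _).le]
      simp only [ENNReal.ofReal_mul (Real.exp_pos _).le]
      exact h.trans (by gcongr)

/-- The tail bound for sums of conditionally sub-Gaussian increments. -/
lemma measure_sum_gt_le (hξ : ∀ t, Measurable (ξ t)) (hlaw : ∀ t, P.map (ξ t) = μ)
    (hind : iIndepFun ξ P) {A : ℕ → Ω → β} (hA : ∀ t, Measurable[past ξ t] (A t))
    {f : ℕ → β × E → ℝ} (hf : ∀ t, Measurable (f t)) {σ : ℕ → ℝ}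
    (hmgf : ∀ θ t b, ∫⁻ e, ENNReal.ofReal (Real.exp (θ * f t (b, e))) ∂μ ≤
      ENNReal.ofReal (Real.exp (θ ^ 2 * σ t ^ 2))) (t : ℕ) {v : ℝ} (hv : 0 < v)
    (hv2 : ∑ s ∈ Finset.range t, σ s ^ 2 ≤ v ^ 2) {L : ℝ} (hL : 0 < L) :
    P {o | L * v < ∑ s ∈ Finset.range t, f s (A s o, ξ s o)} ≤
      ENNReal.ofReal (Real.exp (-(L ^ 2 / 4))) := by
  -- The minimizer of the Chernoff exponent θ²v² - θLv, with value -L²/4.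
  set θ := L / (2 * v) with hθ
  have hθ0 : 0 < θ := by positivity
  obtain ⟨hm, hi⟩ := lintegral_exp_sum_le hξ hlaw hind hA hf (hmgf θ) t
  have hi2 := hi.trans (ENNReal.ofReal_le_ofReal (Real.exp_le_exp.2
    (mul_le_mul_of_nonneg_left hv2 (sq_nonneg θ))))
  have h := measure_le_of_lintegral_exp_le
    ((hm.mono (past_le hξ t) le_rfl).const_mul θ) hi2 (θ * (L * v))
  simp only [mul_lt_mul_iff_right₀ hθ0] at h
  refine h.trans (ENNReal.ofReal_le_ofReal (Real.exp_le_exp.2 (le_of_eq ?_)))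
  rw [hθ]
  field_simp
  ring

/-- The tail bound for weighted sums of sub-exponential terms. -/
lemma measure_weighted_sum_gt_le (hξ : ∀ t, Measurable (ξ t)) (hlaw : ∀ t, P.map (ξ t) = μ)
    (hind : iIndepFun ξ P) {A : ℕ → Ω → β} (hA : ∀ t, Measurable[past ξ t] (A t))
    {f : β × E → ℝ} (hf : Measurable f)
    (htail : ∀ b, ∫⁻ e, ENNReal.ofReal (Real.exp (f (b, e))) ∂μ ≤ ENNReal.ofReal (Real.exp 1))
    (t : ℕ) {c : ℕ → ℝ} (hc : ∀ s, 0 ≤ c s) (hpos : 0 < ∑ s ∈ Finset.range t, c s) (l : ℝ) :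
    P {o | (1 + l) * ∑ s ∈ Finset.range t, c s <
      ∑ s ∈ Finset.range t, c s * f (A s o, ξ s o)} ≤ ENNReal.ofReal (Real.exp (-l)) := by
  set T := ∑ s ∈ Finset.range t, c s with hT
  have hfm : ∀ s, Measurable fun o => f (A s o, ξ s o) := fun s =>
    hf.comp (((hA s).mono (past_le hξ s) le_rfl).prodMk (hξ s))
  have hY : Measurable fun o => ∑ s ∈ Finset.range t, c s / T * f (A s o, ξ s o) :=
    Finset.measurable_sum _ fun s _ => (hfm s).const_mul _
  have hle : ∫⁻ o, ENNReal.ofReal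
      (Real.exp (∑ s ∈ Finset.range t, c s / T * f (A s o, ξ s o))) ∂P ≤
      ENNReal.ofReal (Real.exp 1) := by
    have hp : ∀ s, 0 ≤ c s / T := fun s => div_nonneg (hc s) hpos.le
    have hp1 : ∑ s ∈ Finset.range t, c s / T = 1 := by
      rw [← Finset.sum_div, ← hT, div_self hpos.ne']
    calc _ ≤ ∫⁻ o, ∑ s ∈ Finset.range t, ENNReal.ofReal (c s / T) *
          ENNReal.ofReal (Real.exp (f (A s o, ξ s o))) ∂P := by
          -- Jensen for the weights c_s / T: the terms may depend on one another arbitrarily, since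
          -- only their individual exponential moments enter.
          refine lintegral_mono fun o => ?_
          have := convexOn_exp.map_sum_le (t := Finset.range t) (w := fun s => c s / T)
            (p := fun s => f (A s o, ξ s o)) (fun s _ => hp s) hp1 (fun s _ => mem_univ _)
          simp only [smul_eq_mul] at this
          simp only [← ENNReal.ofReal_mul (hp _)]
          rw [← ENNReal.ofReal_sum_of_nonneg fun s _ => mul_nonneg (hp s) (Real.exp_pos _).le]
          exact ENNReal.ofReal_le_ofReal this
      _ = ∑ s ∈ Finset.range t, ENNReal.ofReal (c s / T) *
          ∫⁻ o, ENNReal.ofReal (Real.exp (f (A s o, ξ s o))) ∂P := by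
          rw [lintegral_finsetSum]
          · refine Finset.sum_congr rfl fun s _ => lintegral_const_mul _ ?_
            exact ((hfm s).exp).ennreal_ofReal
          · intro s _
            exact (((hfm s).exp).ennreal_ofReal).const_mul _
      _ ≤ ∑ s ∈ Finset.range t, ENNReal.ofReal (c s / T) * ENNReal.ofReal (Real.exp 1) := by
          gcongr with s _
          exact lintegral_le_of_past hξ hlaw hind (hA s)
            (f := fun q => ENNReal.ofReal (Real.exp (f q))) (by fun_prop) htail
      _ = _ := by
          rw [← Finset.sum_mul, ← ENNReal.ofReal_sum_of_nonneg fun s _ => hp s, hp1]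
          simp
  have h := measure_le_of_lintegral_exp_le hY hle (1 + l)
  rw [show 1 - (1 + l) = -l by ring] at h
  refine le_trans (measure_mono fun o ho => ?_) h
  simp only [mem_ofPred_eq] at ho ⊢
  rw [← lt_div_iff₀ hpos, Finset.sum_div] at ho
  refine ho.trans_le (le_of_eq (Finset.sum_congr rfl fun s _ => by ring))

end Past

end OVSMD

namespace OVSMD

/-! ### The noise of a stochastic oracle -/

section Oracle

variable {n : ℕ} {E : Type*} [MeasurableSpace E] {μ : Measure E} [IsProbabilityMeasure μ]
  {N : Seminorm ℝ (Vec n)}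

lemma dualNorm_integral_le (hN : ∀ v, N v = 0 → v = 0) {G : E → Vec n} (hG : Measurable G)
    (hi : Integrable G μ) {K : ℝ} (hK : 0 < K)
    (htail : ∫⁻ e, ENNReal.ofReal (Real.exp (dualNorm N (G e) ^ 2 / K ^ 2)) ∂μ ≤
      ENNReal.ofReal (Real.exp 1)) : dualNorm N (∫ e, G e ∂μ) ≤ K := by
  have hdm : Measurable fun e => dualNorm N (G e) := (dualNorm_continuous hN).measurable.comp hG
  obtain ⟨hWi, hWe⟩ := integrable_of_lintegral_ofReal_le
    (W := fun e => Real.exp (dualNorm N (G e) ^ 2 / K ^ 2)) (by fun_prop)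
    (fun e => (Real.exp_pos _).le) (Real.exp_pos 1).le htail
  refine dualNorm_le fun v hv => ?_
  -- With u = ‖G‖_*/K, this is u ≤ (1 + u²)/2 and u² ≤ exp(u² - 1).
  have hpt : ∀ e, inner ℝ (G e) v ≤
      K * (1 / 2 + 1 / 2 * (Real.exp (-1) * Real.exp (dualNorm N (G e) ^ 2 / K ^ 2))) := by
    intro e
    have h1 : dualNorm N (G e) = K * (dualNorm N (G e) / K) := by field_simp
    refine (inner_le_dualNorm_of_le_one hN (G e) hv).trans ?_
    rw [h1]
    gcongr
    rw [← h1, ← Real.exp_add, ← div_pow]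
    set u := dualNorm N (G e) / K
    have h2 := Real.add_one_le_exp (-1 + u ^ 2)
    nlinarith [sq_nonneg (u - 1)]
  rw [real_inner_comm, ← integral_inner hi v]
  calc ∫ e, inner ℝ v (G e) ∂μ ≤ ∫ e, K * (1 / 2 + 1 / 2 * (Real.exp (-1) *
        Real.exp (dualNorm N (G e) ^ 2 / K ^ 2))) ∂μ := by
        refine integral_mono (hi.const_inner v)
          (((integrable_const _).add ((hWi.const_mul _).const_mul _)).const_mul _) fun e => ?_
        rw [real_inner_comm]
        exact hpt e
    _ = K * (1 / 2 + 1 / 2 * (Real.exp (-1) *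
        ∫ e, Real.exp (dualNorm N (G e) ^ 2 / K ^ 2) ∂μ)) := by
        rw [integral_const_mul, integral_add (integrable_const _)
          ((hWi.const_mul _).const_mul _), integral_const_mul, integral_const_mul]
        simp
    _ ≤ K * (1 / 2 + 1 / 2 * (Real.exp (-1) * Real.exp 1)) := by gcongr
    _ = K := by rw [← Real.exp_add]; norm_num

lemma dualNorm_sub_sq_le (hN : ∀ v, N v = 0 → v = 0) {ζ η : Vec n} {K : ℝ}
    (hη : dualNorm N η ≤ K) :
    dualNorm N (ζ - η) ^ 2 ≤ 2 * dualNorm N ζ ^ 2 + 2 * K ^ 2 := by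
  have h1 := dualNorm_add_le hN ζ (-η)
  rw [dualNorm_neg hN, ← sub_eq_add_neg] at h1
  have h2 : dualNorm N (ζ - η) ^ 2 ≤ (dualNorm N ζ + K) ^ 2 :=
    pow_le_pow_left₀ (dualNorm_nonneg hN _) (h1.trans (by gcongr)) 2
  nlinarith [sq_nonneg (dualNorm N ζ - K)]

namespace DistGen

variable {S : Set (Vec n)} (D : DistGen S)

/-- The contribution `√(2 D² K² / α)` of the block to `constM`. -/
noncomputable def scale (K : ℝ) : ℝ := Real.sqrt (2 * D.diam ^ 2 / D.α * K ^ 2)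

lemma scale_sq (K : ℝ) : D.scale K ^ 2 = 2 * D.diam ^ 2 / D.α * K ^ 2 := by
  have := D.α_pos
  exact Real.sq_sqrt (by positivity)

lemma scale_pos (hD : 0 < D.diam) {K : ℝ} (hK : 0 < K) : 0 < D.scale K := by
  have := D.α_pos
  exact Real.sqrt_pos.2 (by positivity)

/-- The constant 4 is what ‖G - g‖_*² ≤ 2‖G‖_*² + 2K² and ‖w - v‖² ≤ 8D²/α produce: the squared
increment over (4 · scale)² is at most 1/2 + ‖G‖_*²/(2K²), whose exponential has mean at most e. -/
lemma noise_mgf (hS : IsClosed S) (hc : Convex ℝ S) (hn : S.Nontrivial) {G : E → Vec n}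
    (hG : Measurable G) (hi : Integrable G μ) {K : ℝ} (hK : 0 < K)
    (htail : ∫⁻ e, ENNReal.ofReal (Real.exp (dualNorm D.N (G e) ^ 2 / K ^ 2)) ∂μ ≤
      ENNReal.ofReal (Real.exp 1)) {v w : Vec n} (hv : v ∈ S) (hw : w ∈ S) (θ : ℝ) :
    ∫⁻ e, ENNReal.ofReal (Real.exp (θ * inner ℝ (G e - ∫ e, G e ∂μ) (w - v))) ∂μ ≤
      ENNReal.ofReal (Real.exp (θ ^ 2 * (4 * D.scale K) ^ 2)) := by
  have hD := D.diam_pos hS hc hn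
  have hα := D.α_pos
  have hdm : Measurable fun e => dualNorm D.N (G e) :=
    (dualNorm_continuous D.definite).measurable.comp hG
  obtain ⟨hWi, hWe⟩ := integrable_of_lintegral_ofReal_le
    (W := fun e => Real.exp (dualNorm D.N (G e) ^ 2 / K ^ 2)) (by fun_prop)
    (fun e => (Real.exp_pos _).le) (Real.exp_pos 1).le htail
  set g := ∫ e, G e ∂μ with hg
  have hgK : dualNorm D.N g ≤ K := dualNorm_integral_le D.definite hG hi hK htail
  have hci : Integrable (fun e => G e - g) μ := hi.sub (integrable_const _)
  refine lintegral_exp_mul_le (by fun_prop) (hci.inner_const _) ?_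
    (mul_pos four_pos (D.scale_pos hD hK)) ?_ θ
  · simp_rw [real_inner_comm (w - v)]
    rw [integral_inner hci, integral_sub hi (integrable_const _)]
    simp [hg]
  · refine lintegral_ofReal_le_of_le (g := fun e => Real.exp (1 / 2) * (Real.exp (1 / 2) *
      ((1 - 1 / 2) + 1 / 2 * (Real.exp (-1) * Real.exp (dualNorm D.N (G e) ^ 2 / K ^ 2)))))
      ((((integrable_const _).add ((hWi.const_mul _).const_mul _)).const_mul _).const_mul _)
      (fun e => (Real.exp_pos _).le) (fun e => ?_) ?_
    · have h1 : inner ℝ (G e - g) (w - v) ^ 2 ≤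
          (2 * dualNorm D.N (G e) ^ 2 + 2 * K ^ 2) * (8 * D.diam ^ 2 / D.α) := by
        rw [← sq_abs]
        calc |inner ℝ (G e - g) (w - v)| ^ 2 ≤ (dualNorm D.N (G e - g) * D.N (w - v)) ^ 2 := by
              gcongr
              exact abs_inner_le_dualNorm D.definite _ _
          _ = dualNorm D.N (G e - g) ^ 2 * D.N (w - v) ^ 2 := by ring
          _ ≤ _ := mul_le_mul (dualNorm_sub_sq_le D.definite hgK)
              (D.seminorm_sq_le hS hc hw hv) (sq_nonneg _) (by positivity)
      have h2 : inner ℝ (G e - g) (w - v) ^ 2 / (4 * D.scale K) ^ 2 ≤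
          1 / 2 + 1 / 2 * (dualNorm D.N (G e) ^ 2 / K ^ 2) := by
        rw [mul_pow, scale_sq, div_le_iff₀ (by positivity)]
        refine h1.trans (le_of_eq ?_)
        field_simp
        ring
      refine (Real.exp_le_exp.2 h2).trans ?_
      rw [Real.exp_add]
      gcongr
      exact exp_mul_le (by norm_num) (by norm_num) _
    · rw [integral_const_mul, integral_const_mul, integral_add (integrable_const _)
          ((hWi.const_mul _).const_mul _), integral_const_mul, integral_const_mul]
      have h1 : Real.exp (-1) * ∫ e, Real.exp (dualNorm D.N (G e) ^ 2 / K ^ 2) ∂μ ≤ 1 := by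
        calc _ ≤ Real.exp (-1) * Real.exp 1 := by gcongr
          _ = 1 := by rw [← Real.exp_add]; simp
      rw [← mul_assoc, ← Real.exp_add]
      simp only [integral_const, probReal_univ, one_smul]
      norm_num only [add_halves]
      refine mul_le_of_le_one_right (Real.exp_pos _).le ?_
      linarith

/-- Uniformly over `w ∈ S`, the accumulated noise of a stochastic oracle is small with high
probability. -/
lemma measure_noise_gt_le (hS : IsClosed S) (hc : Convex ℝ S) (hn : S.Nontrivial)
    {Ω β : Type*} [MeasurableSpace Ω] [MeasurableSpace β] {P : Measure Ω} [IsProbabilityMeasure P]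
    {ξ : ℕ → Ω → E} (hξ : ∀ t, Measurable (ξ t)) (hlaw : ∀ t, P.map (ξ t) = μ)
    (hind : iIndepFun ξ P) {A : ℕ → Ω → β} (hA : ∀ t, Measurable[past ξ t] (A t))
    {G : β × E → Vec n} (hG : Measurable G) (hi : ∀ b, Integrable (fun e => G (b, e)) μ)
    {K : ℝ} (hK : 0 < K)
    (htail : ∀ b, ∫⁻ e, ENNReal.ofReal (Real.exp (dualNorm D.N (G (b, e)) ^ 2 / K ^ 2)) ∂μ ≤
      ENNReal.ofReal (Real.exp 1))
    {v : β → Vec n} (hv : Measurable v) (hvS : ∀ b, v b ∈ S) (γ : ℕ → ℝ) (t : ℕ) {ρ : ℝ}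
    (hρ : 0 < ρ) (hγ : ∑ s ∈ Finset.range t, γ s ^ 2 = ρ ^ 2) {L : ℝ} (hL : 0 < L) (l : ℝ) :
    P {o | ∃ w ∈ S, 1 / 2 + D.scale K ^ 2 * (2 + l) * ρ ^ 2 + 4 * D.scale K * L * ρ <
      ∑ s ∈ Finset.range t,
        γ s * inner ℝ (G (A s o, ξ s o) - ∫ e, G (A s o, e) ∂μ) (w - v (A s o))} ≤
      ENNReal.ofReal (Real.exp (-(L ^ 2 / 4))) + ENNReal.ofReal (Real.exp (-l)) := by
  have hD := D.diam_pos hS hc hn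
  have hκ := D.scale_pos hD hK
  have hg : Measurable fun b => ∫ e, G (b, e) ∂μ :=
    (hG.stronglyMeasurable.integral_prod_right').measurable
  set Δ : β × E → Vec n := fun q => G q - ∫ e, G (q.1, e) ∂μ with hΔ
  have hΔm : Measurable Δ := hG.sub (hg.comp measurable_fst)
  -- The ghost sequence. Dual averaging makes W_s a continuous function of the accumulated noise, so
  -- its measurability with respect to the past is immediate.
  set W : ℕ → Ω → Vec n := fun s o => D.mirror (∑ r ∈ Finset.range s, (-γ r) • Δ (A r o, ξ r o))
    with hW
  have hWS : ∀ s o, W s o ∈ S := fun s o => (D.isArgmin_mirror hS hc hn.nonempty _).1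
  have hWm : ∀ s, Measurable[past ξ s] (W s) := by
    intro s
    refine (D.mirror_continuous hS hc hn).measurable.comp ?_
    refine @Finset.measurable_sum _ _ _ _ _ _ (past ξ s) _ _ fun r hr => ?_
    exact (measurable_past_step (f := fun q => (-γ r) • Δ q) (hA r) (by fun_prop)).mono
      (past_mono ξ (Finset.mem_range.1 hr)) le_rfl
  -- The state is enlarged by the ghost point, kept in `S` so that the moment bound holds for every
  -- value of the state.
  have hA' : ∀ s, Measurable[past ξ s] fun o => ((A s o, ⟨W s o, hWS s o⟩) : β × S) :=
    fun s => (hA s).prodMk ((hWm s).subtype_mk)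
  have hmart := measure_sum_gt_le hξ hlaw hind hA'
    (f := fun s q => γ s * inner ℝ (Δ (q.1.1, q.2)) ((q.1.2 : Vec n) - v q.1.1))
    (fun s => by fun_prop) (σ := fun s => γ s * (4 * D.scale K))
    (fun θ s b => by
      have := D.noise_mgf hS hc hn (hG.comp measurable_prodMk_left) (hi b.1) hK (htail b.1)
        (hvS b.1) b.2.2 (θ * γ s)
      simp only [← mul_assoc]
      refine this.trans (le_of_eq ?_)
      ring_nf) t (v := 4 * D.scale K * ρ) (by positivity)
    (by simp only [mul_pow, ← Finset.sum_mul, hγ]; exact le_of_eq (by ring)) hL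
  have hsec := measure_weighted_sum_gt_le hξ hlaw hind hA
    (f := fun q => dualNorm D.N (G q) ^ 2 / K ^ 2)
    ((((dualNorm_continuous D.definite).measurable.comp hG).pow_const 2).div_const _) htail t
    (c := fun s => γ s ^ 2) (fun s => sq_nonneg _) (by rw [hγ]; positivity) l
  refine (measure_mono ?_).trans ((measure_union_le _ _).trans (add_le_add hmart hsec))
  rintro o ⟨w, hw, ho⟩
  by_contra hcon
  simp only [mem_union, mem_ofPred_eq, not_or, not_lt] at hcon
  obtain ⟨h1, h2⟩ := hcon
  rw [hγ] at h2
  have h3 := D.dualAveraging_regret hS hc hn (fun r => (-γ r) • Δ (A r o, ξ r o)) t hw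
  have h4 : ∑ s ∈ Finset.range t,
      D.diam ^ 2 / D.α * dualNorm D.N ((-γ s) • Δ (A s o, ξ s o)) ^ 2 ≤
      D.scale K ^ 2 * (2 + l) * ρ ^ 2 := by
    have hα := D.α_pos
    calc _ ≤ ∑ s ∈ Finset.range t, (D.scale K ^ 2 *
          (γ s ^ 2 * (dualNorm D.N (G (A s o, ξ s o)) ^ 2 / K ^ 2)) + D.scale K ^ 2 * γ s ^ 2) := by
          refine Finset.sum_le_sum fun s _ => ?_
          have e1 : dualNorm D.N ((-γ s) • Δ (A s o, ξ s o)) ^ 2 ≤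
              γ s ^ 2 * (2 * dualNorm D.N (G (A s o, ξ s o)) ^ 2 + 2 * K ^ 2) := by
            calc _ ≤ (|-γ s| * dualNorm D.N (Δ (A s o, ξ s o))) ^ 2 :=
                  pow_le_pow_left₀ (dualNorm_nonneg D.definite _)
                    (dualNorm_smul_le D.definite _ _) 2
              _ = γ s ^ 2 * dualNorm D.N (Δ (A s o, ξ s o)) ^ 2 := by
                  rw [mul_pow, sq_abs, neg_sq]
              _ ≤ _ := by
                  gcongr
                  exact dualNorm_sub_sq_le D.definite (dualNorm_integral_le D.definite
                    (hG.comp measurable_prodMk_left) (hi _) hK (htail _))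
          rw [scale_sq]
          calc _ ≤ D.diam ^ 2 / D.α *
                (γ s ^ 2 * (2 * dualNorm D.N (G (A s o, ξ s o)) ^ 2 + 2 * K ^ 2)) := by gcongr
            _ = _ := by field_simp
      _ = D.scale K ^ 2 * (∑ s ∈ Finset.range t,
            γ s ^ 2 * (dualNorm D.N (G (A s o, ξ s o)) ^ 2 / K ^ 2)) + D.scale K ^ 2 * ρ ^ 2 := by
          rw [Finset.sum_add_distrib, ← Finset.mul_sum, ← Finset.mul_sum, hγ]
      _ ≤ D.scale K ^ 2 * ((1 + l) * ρ ^ 2) + D.scale K ^ 2 * ρ ^ 2 := by gcongr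
      _ = _ := by ring
  -- Insert W_s between w and v_s: the first sum is the ghost regret, uniform in w, and the second
  -- no longer involves w.
  have h5 : ∑ s ∈ Finset.range t, γ s * inner ℝ (Δ (A s o, ξ s o)) (w - v (A s o)) =
      (∑ s ∈ Finset.range t, inner ℝ ((-γ s) • Δ (A s o, ξ s o)) (W s o - w)) +
      ∑ s ∈ Finset.range t, γ s * inner ℝ (Δ (A s o, ξ s o)) (W s o - v (A s o)) := by
    rw [← Finset.sum_add_distrib]
    refine Finset.sum_congr rfl fun s _ => ?_
    simp only [real_inner_smul_left, inner_sub_right]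
    ring
  have h6 : ∑ s ∈ Finset.range t, inner ℝ ((-γ s) • Δ (A s o, ξ s o)) (W s o - w) ≤
      1 / 2 + D.scale K ^ 2 * (2 + l) * ρ ^ 2 := h3.trans (by linarith)
  change _ < ∑ s ∈ Finset.range t, γ s * inner ℝ (Δ (A s o, ξ s o)) (w - v (A s o)) at ho
  rw [h5] at ho
  have h7 : L * (4 * D.scale K * ρ) = 4 * D.scale K * L * ρ := by ring
  rw [h7] at h1
  linarith

end DistGen

end Oracle

end OVSMD

namespace OVSMD
-- Harmonic sums, step sizes and the iteration count
section Numeric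

lemma two_mul_sqrt_sub_one_le_sum (t : ℕ) :
    2 * (Real.sqrt ((t : ℝ) + 1) - 1) ≤ ∑ s ∈ Finset.range t, 1 / Real.sqrt ((s : ℝ) + 1) := by
  induction t with
  | zero => simp
  | succ t ih =>
    rw [Finset.sum_range_succ]
    push_cast
    set a := Real.sqrt ((t : ℝ) + 1)
    set b := Real.sqrt ((t : ℝ) + 1 + 1)
    have ha : 0 < a := Real.sqrt_pos.2 (by positivity)
    have hab : a ≤ b := Real.sqrt_le_sqrt (by linarith)
    have h1 : a ^ 2 = t + 1 := Real.sq_sqrt (by positivity)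
    have h2 : b ^ 2 = t + 1 + 1 := Real.sq_sqrt (by positivity)
    have h3 : 2 * (b - a) ≤ 1 / a := by
      rw [le_div_iff₀ ha]
      nlinarith
    linarith

lemma sum_inv_le_one_add_log (t : ℕ) :
    ∑ s ∈ Finset.range t, 1 / ((s : ℝ) + 1) ≤ 1 + Real.log t := by
  have h := harmonic_le_one_add_log t
  simpa [harmonic] using h

/-- Tangent lines of log. For a ≤ e, use the tangent at e. For a ≥ e, the tangent at 2a gives a log
τ ≤ τ/2 + a log a, since log 2 ≤ 1. -/
lemma mul_log_le_of_le {a τ : ℝ} (ha : 0 < a) (hτ : 2 * Real.sqrt 2 ≤ τ)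
    (h : 2 * a * Real.log a ≤ τ) : a * Real.log τ ≤ τ := by
  have he : Real.exp 1 < 2 * Real.sqrt 2 := by
    have h1 := Real.exp_one_lt_d9
    have h2 : (1.4 : ℝ) ≤ Real.sqrt 2 := Real.le_sqrt_of_sq_le (by norm_num)
    linarith
  have hτe : Real.exp 1 ≤ τ := he.le.trans hτ
  have hτ0 : 0 < τ := (Real.exp_pos 1).trans_le hτe
  have key : ∀ b, 0 < b → Real.log τ ≤ τ / b + Real.log b - 1 := by
    intro b hb
    have h1 := Real.log_le_sub_one_of_pos (div_pos hτ0 hb)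
    rw [Real.log_div hτ0.ne' hb.ne'] at h1
    linarith
  rcases le_total a (Real.exp 1) with h1 | h1
  · have h2 := key (Real.exp 1) (Real.exp_pos 1)
    rw [Real.log_exp] at h2
    have h3 : Real.log τ ≤ τ / Real.exp 1 := by linarith
    rw [le_div_iff₀ (Real.exp_pos 1)] at h3
    have h4 : 0 ≤ Real.log τ := Real.log_nonneg (by
      have := Real.add_one_le_exp 1
      linarith)
    nlinarith
  · have hla : 1 ≤ Real.log a := (Real.le_log_iff_exp_le ha).2 h1
    have h2 := key (2 * a) (by positivity)
    rw [Real.log_mul two_ne_zero ha.ne'] at h2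
    have h4 : a * (τ / (2 * a)) = τ / 2 := by field_simp
    have h5 : Real.log 2 ≤ 1 := by
      have := Real.log_two_lt_d9
      linarith
    nlinarith

/-- The iteration count `iterBound` balances the harmonic sum against the sum of step sizes. -/
lemma mul_sum_inv_le_of_iterBound {C ε : ℝ} (hC : 0 < C) (hε : 0 < ε) {t : ℕ}
    (ht : iterBound C ε ≤ t) :
    C * ∑ s ∈ Finset.range (t + 1), 1 / ((s : ℝ) + 1) ≤
      ε * ∑ s ∈ Finset.range (t + 1), 1 / Real.sqrt ((s : ℝ) + 1) := by
  have h6 : (6 : ℝ) ≤ t := (le_max_left _ _).trans ht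
  have hB : (8 * C / ε * Real.log (4 * C / ε)) ^ 2 - 2 ≤ t := (le_max_right _ _).trans ht
  have hH := sum_inv_le_one_add_log (t + 1)
  have hS := two_mul_sqrt_sub_one_le_sum (t + 1)
  push_cast at hH hS
  rw [add_assoc, one_add_one_eq_two] at hS
  -- There are t + 1 steps, so the step-size sum is compared with √(t + 2); this matches the -2 in
  -- `iterBound`. The bound t ≥ 6 gives τ² ≥ 8, hence log τ ≥ 1.
  set τ := Real.sqrt ((t : ℝ) + 2) with hτ
  have hτ2 : τ ^ 2 = t + 2 := Real.sq_sqrt (by positivity)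
  have hτ0 : 0 < τ := Real.sqrt_pos.2 (by positivity)
  have hτ8 : 2 * Real.sqrt 2 ≤ τ := by
    refine Real.le_sqrt_of_sq_le ?_
    rw [mul_pow, Real.sq_sqrt zero_le_two]
    linarith
  have hτl : 2 * (4 * C / ε) * Real.log (4 * C / ε) ≤ τ := by
    refine Real.le_sqrt_of_sq_le ?_
    have : 2 * (4 * C / ε) * Real.log (4 * C / ε) = 8 * C / ε * Real.log (4 * C / ε) := by ring
    rw [this]
    linarith
  have h1 := mul_log_le_of_le (by positivity) hτ8 hτl
  have h2 : 4 * C * Real.log τ ≤ ε * τ := by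
    rw [div_mul_eq_mul_div, div_le_iff₀ hε] at h1
    linarith
  have hL : Real.log ((t : ℝ) + 2) = 2 * Real.log τ := by
    rw [← hτ2, Real.log_pow]
    norm_num
  have hL1 : Real.log ((t : ℝ) + 1) ≤ 2 * Real.log τ :=
    hL ▸ Real.log_le_log (by positivity) (by linarith)
  have hlog : 1 ≤ Real.log τ := by
    have h8 : Real.log 8 ≤ Real.log ((t : ℝ) + 2) := Real.log_le_log (by norm_num) (by linarith)
    have : Real.log 8 = 3 * Real.log 2 := by
      rw [show (8 : ℝ) = 2 ^ 3 by norm_num, Real.log_pow]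
      norm_num
    have := Real.log_two_gt_d9
    linarith
  have hτ16 : 2 ≤ τ := by
    have : (1 : ℝ) ≤ Real.sqrt 2 := Real.le_sqrt_of_sq_le (by norm_num)
    linarith
  have h3 : C * (1 + Real.log ((t : ℝ) + 1)) ≤ C * (3 * Real.log τ) := by
    gcongr
    linarith
  calc _ ≤ C * (1 + Real.log ((t : ℝ) + 1)) := by gcongr
    _ ≤ C * (3 * Real.log τ) := h3
    -- From 4C log τ ≤ ετ one has 3C log τ ≤ (3/4)ετ, and (3/4)τ ≤ 2(τ - 1) because τ ≥ 2.
    _ ≤ ε * (2 * (τ - 1)) := by nlinarith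
    _ ≤ _ := by gcongr

lemma one_le_sum_inv (t : ℕ) : 1 ≤ ∑ s ∈ Finset.range (t + 1), 1 / ((s : ℝ) + 1) := by
  rw [Finset.sum_range_succ']
  have : 0 ≤ ∑ s ∈ Finset.range t, 1 / (((s + 1 : ℕ) : ℝ) + 1) :=
    Finset.sum_nonneg fun s _ => by positivity
  simpa using this

/-- The two tails used later have L = Ω(δ) and l = (3/4)Ω(δ); each entry of the maximum in
`constOmega` controls one of them. -/
lemma constOmega_bounds {δ : ℝ} (hδ : δ ∈ Ioo (0 : ℝ) 1) : 0 < constOmega δ ∧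
    Real.exp (-(constOmega δ ^ 2 / 4)) ≤ δ / 24 ∧ Real.exp (-(3 / 4 * constOmega δ)) ≤ δ / 24 := by
  obtain ⟨h0, h1⟩ := hδ
  have hl : 0 < Real.log (24 / δ) := Real.log_pos (by rw [lt_div_iff₀ h0]; linarith)
  have ha : Real.sqrt (12 * Real.log (24 / δ)) ≤ constOmega δ := le_max_left _ _
  have hb : 4 / 3 * Real.log (24 / δ) ≤ constOmega δ := le_max_right _ _
  have he : Real.exp (-Real.log (24 / δ)) = δ / 24 := by
    rw [Real.exp_neg, Real.exp_log (by positivity), inv_div]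
  have hsq : 12 * Real.log (24 / δ) ≤ constOmega δ ^ 2 := by
    rw [← Real.sq_sqrt (by positivity : 0 ≤ 12 * Real.log (24 / δ))]
    gcongr
  refine ⟨by linarith, ?_, ?_⟩ <;> rw [← he] <;> exact Real.exp_le_exp.2 (by linarith)

end Numeric
end OVSMD

namespace OVSMD

/-! ### High-probability regret and validation error in one block -/

namespace DistGen

variable {n : ℕ} {E : Type*} [MeasurableSpace E] {μ : Measure E} [IsProbabilityMeasure μ]
  {S : Set (Vec n)} (D : DistGen S)
  {Ω β : Type*} [MeasurableSpace Ω] [MeasurableSpace β] {P : Measure Ω} [IsProbabilityMeasure P]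
  {ξ : ℕ → Ω → E}

/-- The regret of stochastic mirror descent against the expected oracle. -/
lemma measure_regret_gt_le (hS : IsClosed S) (hc : Convex ℝ S) (hn : S.Nontrivial)
    (hξ : ∀ t, Measurable (ξ t)) (hlaw : ∀ t, P.map (ξ t) = μ)
    (hind : iIndepFun ξ P) {A : ℕ → Ω → β} (hA : ∀ t, Measurable[past ξ t] (A t))
    {G : β × E → Vec n} (hG : Measurable G) (hi : ∀ b, Integrable (fun e => G (b, e)) μ)
    {K : ℝ} (hK : 0 < K)
    (htail : ∀ b, ∫⁻ e, ENNReal.ofReal (Real.exp (dualNorm D.N (G (b, e)) ^ 2 / K ^ 2)) ∂μ ≤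
      ENNReal.ofReal (Real.exp 1))
    {v : β → Vec n} (hv : Measurable v) (hvS : ∀ b, v b ∈ S) {γ : ℕ → ℝ}
    (h0 : ∀ o, D.IsArgmin 0 (v (A 0 o)))
    (hstep : ∀ s o, D.IsArgmin (γ s • G (A s o, ξ s o) - D.regGrad (v (A s o))) (v (A (s + 1) o)))
    (t : ℕ) {ρ : ℝ} (hρ : 0 < ρ) (hγ : ∑ s ∈ Finset.range t, γ s ^ 2 = ρ ^ 2) {L : ℝ}
    (hL : 0 < L) (l : ℝ) :
    P {o | ∃ w ∈ S, 1 + D.scale K ^ 2 * (2.5 + 1.5 * l) * ρ ^ 2 + 4 * D.scale K * L * ρ <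
      ∑ s ∈ Finset.range t, γ s * inner ℝ (∫ e, G (A s o, e) ∂μ) (v (A s o) - w)} ≤
      ENNReal.ofReal (Real.exp (-(L ^ 2 / 4))) + ENNReal.ofReal (Real.exp (-l)) +
        ENNReal.ofReal (Real.exp (-l)) := by
  have hα := D.α_pos
  have hnoise := D.measure_noise_gt_le hS hc hn hξ hlaw hind hA hG hi hK htail hv hvS γ t hρ hγ hL l
  have hsec := measure_weighted_sum_gt_le hξ hlaw hind hA
    (f := fun q => dualNorm D.N (G q) ^ 2 / K ^ 2)
    ((((dualNorm_continuous D.definite).measurable.comp hG).pow_const 2).div_const _) htail t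
    (c := fun s => γ s ^ 2) (fun s => sq_nonneg _) (by rw [hγ]; positivity) l
  refine (measure_mono ?_).trans ((measure_union_le _ _).trans (add_le_add hnoise hsec))
  rintro o ⟨w, hw, ho⟩
  by_contra hcon
  simp only [mem_union, mem_ofPred_eq, not_or, not_lt, not_exists, not_and] at hcon
  obtain ⟨h1, h2⟩ := hcon
  specialize h1 w hw
  rw [hγ] at h2
  have h3 := D.mirrorDescent_regret hS hc hn (v := fun s => v (A s o))
    (ζ := fun s => γ s • G (A s o, ξ s o)) (h0 o) (fun s => hstep s o) t hw
  have h4 : ∑ s ∈ Finset.range t, D.diam ^ 2 / D.α * dualNorm D.N (γ s • G (A s o, ξ s o)) ^ 2 ≤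
      D.scale K ^ 2 / 2 * ((1 + l) * ρ ^ 2) := by
    calc _ ≤ ∑ s ∈ Finset.range t, D.scale K ^ 2 / 2 *
          (γ s ^ 2 * (dualNorm D.N (G (A s o, ξ s o)) ^ 2 / K ^ 2)) := by
          refine Finset.sum_le_sum fun s _ => ?_
          have e1 : dualNorm D.N (γ s • G (A s o, ξ s o)) ^ 2 ≤
              γ s ^ 2 * dualNorm D.N (G (A s o, ξ s o)) ^ 2 := by
            calc _ ≤ (|γ s| * dualNorm D.N (G (A s o, ξ s o))) ^ 2 :=
                  pow_le_pow_left₀ (dualNorm_nonneg D.definite _)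
                    (dualNorm_smul_le D.definite _ _) 2
              _ = _ := by rw [mul_pow, sq_abs]
          rw [scale_sq]
          calc _ ≤ D.diam ^ 2 / D.α * (γ s ^ 2 * dualNorm D.N (G (A s o, ξ s o)) ^ 2) := by gcongr
            _ = _ := by field_simp
      _ ≤ _ := by
          rw [← Finset.mul_sum]
          gcongr
  -- Mean regret is sampled regret plus noise. The two contribute 1/2 + κ²(1 + l)ρ²/2 and 1/2 + κ²(2
  -- + l)ρ² + 4κLρ, where κ = `D.scale K`.
  have h5 : ∑ s ∈ Finset.range t, γ s * inner ℝ (∫ e, G (A s o, e) ∂μ) (v (A s o) - w) =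
      (∑ s ∈ Finset.range t, inner ℝ (γ s • G (A s o, ξ s o)) (v (A s o) - w)) +
      ∑ s ∈ Finset.range t,
        γ s * inner ℝ (G (A s o, ξ s o) - ∫ e, G (A s o, e) ∂μ) (w - v (A s o)) := by
    rw [← Finset.sum_add_distrib]
    refine Finset.sum_congr rfl fun s _ => ?_
    simp only [real_inner_smul_left, inner_sub_right, inner_sub_left]
    ring
  rw [h5] at ho
  linarith

/-- The error of the online validation estimate is small uniformly over `w ∈ S`. -/
lemma measure_validation_gt_le (hS : IsClosed S) (hc : Convex ℝ S) (hn : S.Nontrivial)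
    (hξ : ∀ t, Measurable (ξ t)) (hlaw : ∀ t, P.map (ξ t) = μ)
    (hind : iIndepFun ξ P) {A : ℕ → Ω → β} (hA : ∀ t, Measurable[past ξ t] (A t))
    {G : β × E → Vec n} (hG : Measurable G) (hi : ∀ b, Integrable (fun e => G (b, e)) μ)
    {K : ℝ} (hK : 0 < K)
    (htail : ∀ b, ∫⁻ e, ENNReal.ofReal (Real.exp (dualNorm D.N (G (b, e)) ^ 2 / K ^ 2)) ∂μ ≤
      ENNReal.ofReal (Real.exp 1))
    {v : β → Vec n} (hv : Measurable v) (hvS : ∀ b, v b ∈ S)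
    {Φ : β × E → ℝ} (hΦ : Measurable Φ) (hΦi : ∀ b, Integrable (fun e => Φ (b, e)) μ)
    {Q : ℝ} (hQ : 0 < Q)
    (hΦtail : ∀ b, ∫⁻ e, ENNReal.ofReal
      (Real.exp (|Φ (b, e) - ∫ e, Φ (b, e) ∂μ| ^ 2 / Q ^ 2)) ∂μ ≤ ENNReal.ofReal (Real.exp 1))
    (γ : ℕ → ℝ) (t : ℕ) {ρ : ℝ} (hρ : 0 < ρ) (hγ : ∑ s ∈ Finset.range t, γ s ^ 2 = ρ ^ 2)
    {L : ℝ} (hL : 0 < L) (l : ℝ) :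
    P {o | ∃ w ∈ S, 1 / 2 + D.scale K ^ 2 * (2 + l) * ρ ^ 2 + 4 * D.scale K * L * ρ + Q * L * ρ <
      |∑ s ∈ Finset.range t, γ s * (Φ (A s o, ξ s o) - ∫ e, Φ (A s o, e) ∂μ +
        inner ℝ (G (A s o, ξ s o) - ∫ e, G (A s o, e) ∂μ) (w - v (A s o)))|} ≤
      4 * ENNReal.ofReal (Real.exp (-(L ^ 2 / 4))) + 2 * ENNReal.ofReal (Real.exp (-l)) := by
  have hφ : Measurable fun b => ∫ e, Φ (b, e) ∂μ :=
    (hΦ.stronglyMeasurable.integral_prod_right').measurable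
  have hmart : ∀ γ' : ℕ → ℝ, ∑ s ∈ Finset.range t, γ' s ^ 2 = ρ ^ 2 →
      P {o | L * (Q * ρ) <
        ∑ s ∈ Finset.range t, γ' s * (Φ (A s o, ξ s o) - ∫ e, Φ (A s o, e) ∂μ)} ≤
        ENNReal.ofReal (Real.exp (-(L ^ 2 / 4))) := fun γ' hγ' =>
    measure_sum_gt_le hξ hlaw hind hA (f := fun s q => γ' s * (Φ q - ∫ e, Φ (q.1, e) ∂μ))
      (fun s => (hΦ.sub (hφ.comp measurable_fst)).const_mul _) (σ := fun s => γ' s * Q)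
      (fun θ s b => by
        have := lintegral_exp_mul_le (μ := μ) (X := fun e => Φ (b, e) - ∫ e, Φ (b, e) ∂μ)
          ((hΦ.comp measurable_prodMk_left).sub_const _) ((hΦi b).sub (integrable_const _))
          (by rw [integral_sub (hΦi b) (integrable_const _)]; simp) hQ
          (by simpa only [sq_abs] using hΦtail b) (θ * γ' s)
        simp only [← mul_assoc]
        refine this.trans (le_of_eq ?_)
        ring_nf) t (by positivity)
      (by simp only [mul_pow, ← Finset.sum_mul, hγ']; exact le_of_eq (by ring)) hL
  -- The absolute value is handled by running the one-sided bounds also with the weights -γ_s; the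
  -- step sizes enter them with arbitrary sign.
  have hγn : ∑ s ∈ Finset.range t, (-γ s) ^ 2 = ρ ^ 2 := by simpa only [neg_sq] using hγ
  have m1 := hmart γ hγ
  have m2 := hmart (fun s => -γ s) hγn
  have n1 := D.measure_noise_gt_le hS hc hn hξ hlaw hind hA hG hi hK htail hv hvS γ t hρ hγ hL l
  have n2 := D.measure_noise_gt_le hS hc hn hξ hlaw hind hA hG hi hK htail hv hvS
    (fun s => -γ s) t hρ hγn hL l
  refine ((measure_mono ?_).trans ((measure_union_le _ _).trans (add_le_add
    ((measure_union_le _ _).trans (add_le_add m1 m2))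
    ((measure_union_le _ _).trans (add_le_add n1 n2))))).trans (le_of_eq (by ring))
  rintro o ⟨w, hw, ho⟩
  by_contra hcon
  simp only [mem_union, mem_ofPred_eq, not_or, not_lt, not_exists, not_and, neg_mul,
    Finset.sum_neg_distrib] at hcon
  obtain ⟨⟨h1, h2⟩, h3, h4⟩ := hcon
  specialize h3 w hw
  specialize h4 w hw
  simp only [mul_add, Finset.sum_add_distrib] at ho
  rcases lt_abs.1 ho with h | h <;> linarith

end DistGen

/-! ### Comparison of extrema, and the simplex -/

section Bounds

variable {α₁ α₂ : Type*}

lemma sSup_sub_sInf_le {S : Set α₁} {T : Set α₂} (hS : S.Nonempty) (hT : T.Nonempty)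
    {f : α₁ → ℝ} {g : α₂ → ℝ} {c : ℝ} (h : ∀ a ∈ S, ∀ b ∈ T, f a - g b ≤ c) :
    sSup (f '' S) - sInf (g '' T) ≤ c := by
  rw [sub_le_iff_le_add]
  refine csSup_le (hS.image f) ?_
  rintro _ ⟨a, ha, rfl⟩
  rw [← sub_le_iff_le_add']
  refine le_csInf (hT.image g) ?_
  rintro _ ⟨b, hb, rfl⟩
  linarith [h a ha b hb]

lemma abs_sSup_sub_sSup_le {S : Set α₁} (hS : S.Nonempty) {f g : α₁ → ℝ}
    (hf : BddAbove (f '' S)) (hg : BddAbove (g '' S)) {c : ℝ} (h : ∀ a ∈ S, |f a - g a| ≤ c) :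
    |sSup (f '' S) - sSup (g '' S)| ≤ c := by
  have key : ∀ f g : α₁ → ℝ, BddAbove (g '' S) → (∀ a ∈ S, |f a - g a| ≤ c) →
      sSup (f '' S) - sSup (g '' S) ≤ c := by
    intro f g hg h
    rw [sub_le_iff_le_add]
    refine csSup_le (hS.image f) ?_
    rintro _ ⟨a, ha, rfl⟩
    have := le_csSup hg ⟨a, ha, rfl⟩
    linarith [(abs_le.1 (h a ha)).2]
  refine abs_sub_le_iff.2 ⟨key f g hg h, key g f hf fun a ha => ?_⟩
  rw [abs_sub_comm]
  exact h a ha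

lemma abs_sInf_sub_sInf_le {S : Set α₁} (hS : S.Nonempty) {f g : α₁ → ℝ}
    (hf : BddBelow (f '' S)) (hg : BddBelow (g '' S)) {c : ℝ} (h : ∀ a ∈ S, |f a - g a| ≤ c) :
    |sInf (f '' S) - sInf (g '' S)| ≤ c := by
  have key : ∀ f g : α₁ → ℝ, BddBelow (f '' S) → (∀ a ∈ S, |f a - g a| ≤ c) →
      sInf (f '' S) - sInf (g '' S) ≤ c := by
    intro f g hf h
    rw [sub_le_iff_le_add', ← sub_le_iff_le_add]
    refine le_csInf (hS.image g) ?_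
    rintro _ ⟨a, ha, rfl⟩
    have := csInf_le hf ⟨a, ha, rfl⟩
    linarith [(abs_le.1 (h a ha)).2]
  refine abs_sub_le_iff.2 ⟨key f g hf h, key g f hg fun a ha => ?_⟩
  rw [abs_sub_comm]
  exact h a ha

lemma continuous_wavg_affine {n : ℕ} (γ a : ℕ → ℝ) (v z : ℕ → Vec n) (t : ℕ) :
    Continuous fun w => wavg γ (fun s => a s + inner ℝ (v s) (w - z s)) t := by
  unfold wavg
  fun_prop

lemma wavg_sub (γ a b : ℕ → ℝ) (t : ℕ) :
    wavg γ a t - wavg γ b t =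
      (∑ s ∈ Finset.range (t + 1), γ s * (a s - b s)) / ∑ s ∈ Finset.range (t + 1), γ s := by
  simp only [wavg, ← sub_div, ← Finset.sum_sub_distrib, mul_sub]

lemma isClosed_simplex (n : ℕ) : IsClosed (simplex n) := by
  have : simplex n = (⋂ i, {y : Vec n | 0 ≤ y i}) ∩ {y : Vec n | ∑ i, y i = 1} := by
    ext y
    simp [simplex]
  rw [this]
  exact (isClosed_iInter fun i => isClosed_le continuous_const (by fun_prop)).inter
    (isClosed_eq (by fun_prop) continuous_const)

lemma convex_simplex (n : ℕ) : Convex ℝ (simplex n) := by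
  intro y hy z hz a b ha hb hab
  refine ⟨fun i => ?_, ?_⟩
  · have h1 := hy.1 i
    have h2 := hz.1 i
    simp only [PiLp.add_apply, PiLp.smul_apply, smul_eq_mul]
    positivity
  · simp only [PiLp.add_apply, PiLp.smul_apply, smul_eq_mul, Finset.sum_add_distrib,
      ← Finset.mul_sum, hy.2, hz.2, mul_one, hab]

lemma nontrivial_simplex {m : ℕ} (hm : 1 ≤ m) : (simplex (m + 1)).Nontrivial := by
  have hmem : ∀ i : Fin (m + 1), EuclideanSpace.single i (1 : ℝ) ∈ simplex (m + 1) := fun i => by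
    refine ⟨fun j => ?_, by simp⟩
    rw [PiLp.single_apply]
    split_ifs <;> norm_num
  refine ⟨_, hmem 0, _, hmem (Fin.last m), fun h => ?_⟩
  have h0 : (0 : Fin (m + 1)) ≠ Fin.last m := by
    intro h
    have := congrArg Fin.val h
    simp at this
    omega
  have := congrArg (fun y : Vec (m + 1) => y 0) h
  simp [h0] at this

end Bounds

end OVSMD

namespace OVSMD

/-! ### The prox-mapping splits into the two blocks -/

section Prox

variable {d k : ℕ} {X : Set (Vec d)} {Y : Set (Vec k)} {dx : DistGen X} {dy : DistGen Y}

lemma omegaZ_eq (z : Vec d × Vec k) : omegaZ dx dy z = dx.reg z.1 + dy.reg z.2 := rfl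

lemma gradZ_eq (z : Vec d × Vec k) : gradZ dx dy z = (dx.regGrad z.1, dy.regGrad z.2) := rfl

/-- Vary only the first component: the objective is a sum over blocks, so the terms in z.2 cancel.
-/
lemma IsProx.isArgmin_fst {z' ζ z : Vec d × Vec k} (h : IsProx dx dy z' ζ z) :
    dx.IsArgmin (ζ.1 - dx.regGrad z'.1) z.1 := by
  refine ⟨h.1.1, fun w hw => ?_⟩
  have := h.2 (show (w, z.2) ∈ X ×ˢ Y from ⟨hw, h.1.2⟩)
  simp only [mem_ofPred_eq, pairing, bregman, omegaZ_eq, gradZ_eq, Prod.fst_sub, Prod.snd_sub,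
    inner_sub_right] at this
  simp only [inner_sub_left]
  linarith

lemma IsProx.isArgmin_snd {z' ζ z : Vec d × Vec k} (h : IsProx dx dy z' ζ z) :
    dy.IsArgmin (ζ.2 - dy.regGrad z'.2) z.2 := by
  refine ⟨h.1.2, fun w hw => ?_⟩
  have := h.2 (show (z.1, w) ∈ X ×ˢ Y from ⟨h.1.1, hw⟩)
  simp only [mem_ofPred_eq, pairing, bregman, omegaZ_eq, gradZ_eq, Prod.fst_sub, Prod.snd_sub,
    inner_sub_right] at this
  simp only [inner_sub_left]
  linarith

lemma isArgmin_of_isMinOn_omegaZ {z : Vec d × Vec k} (hz : z ∈ X ×ˢ Y)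
    (h : IsMinOn (omegaZ dx dy) (X ×ˢ Y) z) : dx.IsArgmin 0 z.1 ∧ dy.IsArgmin 0 z.2 := by
  refine ⟨⟨hz.1, fun w hw => ?_⟩, ⟨hz.2, fun w hw => ?_⟩⟩
  · have := h (show (w, z.2) ∈ X ×ˢ Y from ⟨hw, hz.2⟩)
    simp only [mem_ofPred_eq, omegaZ_eq] at this
    simp only [inner_zero_left]
    linarith
  · have := h (show (z.1, w) ∈ X ×ˢ Y from ⟨hz.1, hw⟩)
    simp only [mem_ofPred_eq, omegaZ_eq] at this
    simp only [inner_zero_left]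
    linarith

end Prox

namespace DistGen

variable {n : ℕ} {S : Set (Vec n)} {D : DistGen S} {Ω : Type*} [MeasurableSpace Ω]

lemma measurable_of_isArgmin (hS : IsClosed S) (hc : Convex ℝ S) (hn : S.Nontrivial)
    {η v : Ω → Vec n} (hη : Measurable η) (h : ∀ o, D.IsArgmin (η o) (v o)) : Measurable v := by
  have : v = fun o => D.mirror (η o) := funext fun o =>
    (h o).unique hc (D.diam_pos hS hc hn) (D.isArgmin_mirror hS hc hn.nonempty _)
  rw [this]
  exact (D.mirror_continuous hS hc hn).measurable.comp hη

/-- The gradient is only known to be continuous on the subdifferential domain, so it is composed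
with the iterate viewed in that subtype. -/
lemma measurable_regGrad {v : Ω → Vec n} (hv : Measurable v)
    (h : ∀ o, v o ∈ subdiffDomain S D.fn) : Measurable fun o => D.regGrad (v o) := by
  have h1 : Measurable fun o => (⟨v o, h o⟩ : subdiffDomain S D.fn) := hv.subtype_mk
  have h2 : Measurable fun q : subdiffDomain S D.fn => D.grad q :=
    (continuousOn_iff_continuous_domRestrict.1 D.continuousOn_grad).measurable
  exact (h2.comp h1).const_smul (1 / (2 * D.diam ^ 2))

end DistGen

/-! ### Joint measurability of the oracle -/

section Oracle

variable {d m : ℕ} {Ξ : Fin (m + 1) → Type*} [∀ i, MeasurableSpace (Ξ i)] (p : SOEC d m Ξ)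

/-- A Carathéodory function: continuous in x and measurable in the sample. -/
lemma SOEC.measurable_F (i : Fin (m + 1)) :
    Measurable fun q : (p.X × simplex (m + 1)) × (∀ i, Ξ i) => p.F i q.1.1 (q.2 i) := by
  have h : Measurable (Function.uncurry fun (x : p.X) (s : Ξ i) => p.F i x s) :=
    measurable_uncurry_of_continuous_of_measurable
      (fun s => continuousOn_iff_continuous_domRestrict.1 (p.F_continuous i s))
      (fun x => p.F_measurable i x x.2)
  have h2 : Measurable fun q : (p.X × simplex (m + 1)) × (∀ i, Ξ i) => (q.1.1, q.2 i) := by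
    fun_prop
  exact h.comp h2

lemma measurable_coord (i : Fin (m + 1)) :
    Measurable fun q : (p.X × simplex (m + 1)) × (∀ i, Ξ i) => (q.1.2 : Vec (m + 1)) i := by
  fun_prop

lemma SOEC.measurable_Phi :
    Measurable fun q : (p.X × simplex (m + 1)) × (∀ i, Ξ i) => p.Phi q.1.1 q.1.2 q.2 := by
  unfold SOEC.Phi
  exact Finset.measurable_sum _ fun i _ =>
    (measurable_coord p i).mul ((p.measurable_F i).sub_const _)

lemma SOEC.measurable_Gy :
    Measurable fun q : (p.X × simplex (m + 1)) × (∀ i, Ξ i) => p.Gy q.1.1 q.2 := by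
  unfold SOEC.Gy
  exact (WithLp.measurable_toLp 2 _).comp
    (measurable_pi_lambda _ fun i => (p.measurable_F i).sub_const _)

lemma measurable_Gx {F' : ∀ i, Vec d → Ξ i → Vec d}
    (hF' : ∀ i, Measurable (fun q : p.X × Ξ i => F' i (q.1 : Vec d) q.2)) :
    Measurable fun q : (p.X × simplex (m + 1)) × (∀ i, Ξ i) => Gx F' q.1.1 q.1.2 q.2 := by
  unfold Gx
  refine Finset.measurable_sum _ fun i _ => (measurable_coord p i).smul ?_
  have h2 : Measurable fun q : (p.X × simplex (m + 1)) × (∀ i, Ξ i) => (q.1.1, q.2 i) := by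
    fun_prop
  exact (hF' i).comp h2

lemma SOEC.integrable_Phi {x : Vec d} (hx : x ∈ p.X) (y : Vec (m + 1)) :
    Integrable (p.Phi x y) p.law := by
  have := p.isProb
  unfold SOEC.Phi
  exact integrable_finsetSum _ fun i _ =>
    ((p.F_integrable i x hx).sub (integrable_const _)).const_mul _

end Oracle

/-! ### Adaptedness of the iterates, and step-size sums -/

section Run

variable {d m : ℕ} {Ξ : Fin (m + 1) → Type*} [∀ i, MeasurableSpace (Ξ i)] {p : SOEC d m Ξ}
  {dx : DistGen p.X} {dy : DistGen (simplex (m + 1))} {F' : ∀ i, Vec d → Ξ i → Vec d}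
  {γ : ℕ → ℝ} {Ω : Type*} {ξ : ℕ → Ω → ∀ i, Ξ i} {x : ℕ → Ω → Vec d} {y : ℕ → Ω → Vec (m + 1)}

lemma IsRun.mem (h : IsRun p dx dy F' γ ξ x y) (t : ℕ) (o : Ω) :
    x t o ∈ p.X ∧ y t o ∈ simplex (m + 1) := by
  cases t with
  | zero => exact (h.init o).1
  | succ t => exact (h.step t o).1

/-- The iterates as points of `X × Y`. -/
def IsRun.state (h : IsRun p dx dy F' γ ξ x y) (t : ℕ) (o : Ω) : p.X × simplex (m + 1) :=
  (⟨x t o, (h.mem t o).1⟩, ⟨y t o, (h.mem t o).2⟩)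

lemma IsRun.init_x (h : IsRun p dx dy F' γ ξ x y) (o : Ω) : dx.IsArgmin 0 (x 0 o) :=
  (isArgmin_of_isMinOn_omegaZ (h.init o).1 (h.init o).2).1

lemma IsRun.init_y (h : IsRun p dx dy F' γ ξ x y) (o : Ω) : dy.IsArgmin 0 (y 0 o) :=
  (isArgmin_of_isMinOn_omegaZ (h.init o).1 (h.init o).2).2

lemma IsRun.step_x (h : IsRun p dx dy F' γ ξ x y) (t : ℕ) (o : Ω) :
    dx.IsArgmin (γ t • Gx F' (x t o) (y t o) (ξ t o) - dx.regGrad (x t o)) (x (t + 1) o) :=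
  (h.step t o).isArgmin_fst

lemma IsRun.step_y (h : IsRun p dx dy F' γ ξ x y) (t : ℕ) (o : Ω) :
    dy.IsArgmin (γ t • (-p.Gy (x t o) (ξ t o)) - dy.regGrad (y t o)) (y (t + 1) o) :=
  (h.step t o).isArgmin_snd

lemma IsRun.measurable_state (h : IsRun p dx dy F' γ ξ x y) (hm : 1 ≤ m) (hX : p.X.Nontrivial)
    (hF' : ∀ i, Measurable (fun q : p.X × Ξ i => F' i (q.1 : Vec d) q.2)) (t : ℕ) :
    Measurable[past ξ t] (h.state t) := by
  have hY := nontrivial_simplex hm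
  have hDx := dx.diam_pos p.isClosed p.convex hX
  have hDy := dy.diam_pos (isClosed_simplex _) (convex_simplex _) hY
  -- The induction must also carry membership in the subdifferential domains, without which the
  -- gradient in the next step is not known to be measurable.
  suffices H : (Measurable[past ξ t] (x t) ∧ Measurable[past ξ t] (y t)) ∧
      (∀ o, x t o ∈ subdiffDomain p.X dx.fn) ∧
      (∀ o, y t o ∈ subdiffDomain (simplex (m + 1)) dy.fn) from
    (H.1.1.subtype_mk).prodMk (H.1.2.subtype_mk)
  induction t with
  | zero =>
    exact ⟨⟨@DistGen.measurable_of_isArgmin _ _ _ _ (past ξ 0) p.isClosed p.convex hX _ _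
      (@measurable_const _ _ _ (past ξ 0) 0) h.init_x,
      @DistGen.measurable_of_isArgmin _ _ _ _ (past ξ 0) (isClosed_simplex _) (convex_simplex _) hY
      _ _ (@measurable_const _ _ _ (past ξ 0) 0) h.init_y⟩,
      fun o => (h.init_x o).mem_subdiffDomain hDx, fun o => (h.init_y o).mem_subdiffDomain hDy⟩
  | succ t ih =>
    obtain ⟨⟨ihx, ihy⟩, hx, hy⟩ := ih
    have hs : Measurable[past ξ t] (h.state t) := (ihx.subtype_mk).prodMk (ihy.subtype_mk)
    have hle := past_mono ξ t.le_succ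
    have g1 := @DistGen.measurable_regGrad _ _ dx _ (past ξ (t + 1)) _ (ihx.mono hle le_rfl) hx
    have g2 := @DistGen.measurable_regGrad _ _ dy _ (past ξ (t + 1)) _ (ihy.mono hle le_rfl) hy
    have s1 := measurable_past_step (ξ := ξ) hs ((measurable_Gx p hF').const_smul (γ t))
    have s2 := measurable_past_step (ξ := ξ) hs (p.measurable_Gy.neg.const_smul (γ t))
    exact ⟨⟨@DistGen.measurable_of_isArgmin _ _ _ _ (past ξ (t + 1)) p.isClosed p.convex hX _ _
      (s1.sub g1) (h.step_x t), @DistGen.measurable_of_isArgmin _ _ _ _ (past ξ (t + 1))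
      (isClosed_simplex _) (convex_simplex _) hY _ _ (s2.sub g2) (h.step_y t)⟩,
      fun o => (h.step_x t o).mem_subdiffDomain hDx, fun o => (h.step_y t o).mem_subdiffDomain hDy⟩

end Run

lemma constM_sq {d k : ℕ} {X : Set (Vec d)} {Y : Set (Vec k)} (dx : DistGen X) (dy : DistGen Y)
    (Mx My : ℝ) : constM dx dy Mx My ^ 2 = dx.scale Mx ^ 2 + dy.scale My ^ 2 := by
  have h1 := dx.α_pos
  have h2 := dy.α_pos
  rw [constM, Real.sq_sqrt (by positivity), dx.scale_sq, dy.scale_sq]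

/-- The steps `1 / (M √(s + 1))`: their sum, and the root of the sum of their squares. -/
lemma stepsize_sums {M : ℝ} (hM : 0 < M) {γ : ℕ → ℝ}
    (hγ : ∀ t, γ t = 1 / (M * Real.sqrt ((t : ℝ) + 1))) (t : ℕ) :
    M * ∑ s ∈ Finset.range (t + 1), γ s =
      ∑ s ∈ Finset.range (t + 1), 1 / Real.sqrt ((s : ℝ) + 1) ∧
    ∃ ρ : ℝ, 0 < ρ ∧ ∑ s ∈ Finset.range (t + 1), γ s ^ 2 = ρ ^ 2 ∧ 1 ≤ M * ρ ∧
      (M * ρ) ^ 2 = ∑ s ∈ Finset.range (t + 1), 1 / ((s : ℝ) + 1) := by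
  constructor
  · rw [Finset.mul_sum]
    refine Finset.sum_congr rfl fun s _ => ?_
    have : 0 < Real.sqrt ((s : ℝ) + 1) := Real.sqrt_pos.2 (by positivity)
    rw [hγ]
    field_simp
  · have h1 := one_le_sum_inv t
    set H := ∑ s ∈ Finset.range (t + 1), 1 / ((s : ℝ) + 1) with hH
    have hsq : Real.sqrt H ^ 2 = H := Real.sq_sqrt (by linarith)
    have hMρ : M * (Real.sqrt H / M) = Real.sqrt H := by field_simp
    refine ⟨Real.sqrt H / M, div_pos (Real.sqrt_pos.2 (by linarith)) hM, ?_, ?_, ?_⟩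
    · rw [div_pow, hsq, hH, Finset.sum_div]
      refine Finset.sum_congr rfl fun s _ => ?_
      rw [hγ, div_pow, mul_pow, Real.sq_sqrt (by positivity)]
      field_simp
    · rw [hMρ]
      exact Real.one_le_sqrt.2 h1
    · rw [hMρ, hsq]

end OVSMD

namespace OVSMD

/-! ### Error budgets -/

lemma scale_le_constM {d k : ℕ} {X : Set (Vec d)} {Y : Set (Vec k)} (dx : DistGen X)
    (dy : DistGen Y) (Mx My : ℝ) :
    dx.scale Mx ≤ constM dx dy Mx My ∧ dy.scale My ≤ constM dx dy Mx My := by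
  have h := constM_sq dx dy Mx My
  exact ⟨Real.le_sqrt_of_sq_le (by
      rw [constM, Real.sq_sqrt (by have := dx.α_pos; have := dy.α_pos; positivity)] at h
      linarith [sq_nonneg (dy.scale My)]),
    Real.le_sqrt_of_sq_le (by
      rw [constM, Real.sq_sqrt (by have := dx.α_pos; have := dy.α_pos; positivity)] at h
      linarith [sq_nonneg (dx.scale Mx)])⟩

/-- The validation error of one block fits into the budget fixed by `iterBound`. -/
lemma validation_budget {κ M Q L ρ B H : ℝ} (hM : 0 < M) (hκ : 0 < κ) (hκM : κ ≤ M)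
    (hQ : 0 < Q) (hL : 0 < L) (hρ : 0 < ρ) (h1 : 1 ≤ M * ρ) (hH : (M * ρ) ^ 2 = H)
    (hB : (Q * L + 8 * M * L + 2.5 * M) * H ≤ M * B) :
    1 / 2 + κ ^ 2 * (2 + 3 / 4 * L) * ρ ^ 2 + 4 * κ * L * ρ + Q * L * ρ ≤ B := by
  refine le_of_mul_le_mul_left (le_trans ?_ hB) hM
  -- Since Mρ ≥ 1, both constants and terms linear in Mρ are dominated by H = (Mρ)².
  have hH1 : M * ρ ≤ H := by rw [← hH]; nlinarith
  have e1 : κ ^ 2 * (2 + 3 / 4 * L) * ρ ^ 2 ≤ (2 + 3 / 4 * L) * H := by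
    calc κ ^ 2 * (2 + 3 / 4 * L) * ρ ^ 2 ≤ M ^ 2 * (2 + 3 / 4 * L) * ρ ^ 2 := by gcongr
      _ = (2 + 3 / 4 * L) * H := by rw [← hH]; ring
  have e2 : 4 * κ * L * ρ ≤ 4 * L * H := by
    calc 4 * κ * L * ρ ≤ 4 * M * L * ρ := by gcongr
      _ = 4 * L * (M * ρ) := by ring
      _ ≤ _ := by gcongr
  have e3 : M * (Q * L * ρ) ≤ Q * L * H := by
    calc M * (Q * L * ρ) = Q * L * (M * ρ) := by ring
      _ ≤ _ := by gcongr
  have e4 : M * (1 / 2 + κ ^ 2 * (2 + 3 / 4 * L) * ρ ^ 2 + 4 * κ * L * ρ) ≤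
      M * (1 / 2 * H + (2 + 3 / 4 * L) * H + 4 * L * H) := by
    gcongr
    linarith
  have e5 : 0 ≤ M * L * H := by
    have : 0 ≤ H := by linarith
    positivity
  nlinarith

/-- The regrets of the two blocks fit into the budget fixed by `iterBound`. -/
lemma gap_budget {κ₁ κ₂ M L ρ B H : ℝ} (hM : 0 < M) (hκ₁M : κ₁ ≤ M) (hκ₂M : κ₂ ≤ M)
    (hκ : M ^ 2 = κ₁ ^ 2 + κ₂ ^ 2) (hL : 0 < L) (hρ : 0 < ρ) (h1 : 1 ≤ M * ρ)
    (hH : (M * ρ) ^ 2 = H) (hB : (10 * M * L + 4.5 * M) * H ≤ M * B) :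
    (1 + κ₁ ^ 2 * (2.5 + 1.5 * (3 / 4 * L)) * ρ ^ 2 + 4 * κ₁ * L * ρ) +
      (1 + κ₂ ^ 2 * (2.5 + 1.5 * (3 / 4 * L)) * ρ ^ 2 + 4 * κ₂ * L * ρ) ≤ B := by
  have hB' : (10 * L + 4.5) * H ≤ B := le_of_mul_le_mul_left (by linarith) hM
  have hH1 : M * ρ ≤ H := by rw [← hH]; nlinarith
  -- The quadratic terms of the blocks add up exactly, through κ₁² + κ₂² = M². In total the
  -- coefficient of H is 4.5 + 9.125 L, within 4.5 + 10 L.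
  have e1 : κ₁ ^ 2 * (2.5 + 1.5 * (3 / 4 * L)) * ρ ^ 2 + κ₂ ^ 2 * (2.5 + 1.5 * (3 / 4 * L)) * ρ ^ 2 =
      (2.5 + 1.5 * (3 / 4 * L)) * H := by
    rw [← hH, mul_pow, hκ]; ring
  have e2 : ∀ κ ≤ M, 4 * κ * L * ρ ≤ 4 * L * H := fun κ hκ => by
    calc 4 * κ * L * ρ ≤ 4 * M * L * ρ := by gcongr
      _ = 4 * L * (M * ρ) := by ring
      _ ≤ _ := by gcongr
  have e3 := e2 κ₁ hκ₁M
  have e4 := e2 κ₂ hκ₂M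
  have e5 : 0 ≤ L * H := mul_nonneg hL.le (by linarith)
  linarith

end OVSMD

/-! ### Assembly of the proposition -/

theorem proposition2 {d m : ℕ} (hm : 1 ≤ m) {Ξ : Fin (m + 1) → Type*}
    [∀ i, MeasurableSpace (Ξ i)] (p : OVSMD.SOEC d m Ξ) (hX : p.X.Nontrivial)
    (dx : OVSMD.DistGen p.X) (dy : OVSMD.DistGen (OVSMD.simplex (m + 1)))
    (F' : ∀ i, OVSMD.Vec d → Ξ i → OVSMD.Vec d) (Mx My Q : ℝ)
    (hA : OVSMD.LightTail p dx dy F' Mx My Q)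
    {Ω : Type*} [MeasurableSpace Ω] (P : Measure Ω) [IsProbabilityMeasure P]
    (ξ : ℕ → Ω → ∀ i, Ξ i) (hξ : ∀ t, Measurable (ξ t)) (hlaw : ∀ t, P.map (ξ t) = p.law)
    (hind : iIndepFun ξ P)
    (ε : ℝ) (hε : 0 < ε) (δ : ℝ) (hδ : δ ∈ Ioo (0 : ℝ) 1)
    (M : ℝ) (hM : M = OVSMD.constM dx dy Mx My)
    (γ : ℕ → ℝ) (hγ : ∀ t, γ t = 1 / (M * Real.sqrt ((t : ℝ) + 1)))
    (x : ℕ → Ω → OVSMD.Vec d) (y : ℕ → Ω → OVSMD.Vec (m + 1))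
    (hrun : OVSMD.IsRun p dx dy F' γ ξ x y) :
    (∀ t : ℕ, OVSMD.iterBound (10 * M * OVSMD.constOmega δ + 4.5 * M) ε ≤ (t : ℝ) →
      P {o | ε < OVSMD.uStar p γ (fun s => x s o) (fun s => y s o) t
        - OVSMD.lStar p F' γ (fun s => x s o) (fun s => y s o) t} ≤ ENNReal.ofReal δ) ∧
    (∀ t : ℕ, OVSMD.iterBound
        (Q * OVSMD.constOmega δ + 8 * M * OVSMD.constOmega δ + 2.5 * M) ε ≤ (t : ℝ) →
      P {o | ε < |OVSMD.lHat p F' γ (fun s => ξ s o) (fun s => x s o) (fun s => y s o) t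
        - OVSMD.lStar p F' γ (fun s => x s o) (fun s => y s o) t|} ≤ ENNReal.ofReal δ ∧
      P {o | ε < |OVSMD.uHat p γ (fun s => ξ s o) (fun s => x s o) (fun s => y s o) t
        - OVSMD.uStar p γ (fun s => x s o) (fun s => y s o) t|} ≤ ENNReal.ofReal δ) := by
  have hY := OVSMD.nontrivial_simplex hm
  have hYcl := OVSMD.isClosed_simplex (m + 1)
  have hYco := OVSMD.convex_simplex (m + 1)
  have hDx := dx.diam_pos p.isClosed p.convex hX
  have hDy := dy.diam_pos hYcl hYco hY
  have hXK := dx.isCompact p.isClosed p.convex hX.nonempty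
  have hYK := dy.isCompact hYcl hYco hY.nonempty
  have hprob := p.isProb
  have hκx := dx.scale_pos hDx hA.Mx_pos
  have hκy := dy.scale_pos hDy hA.My_pos
  obtain ⟨hκxM, hκyM⟩ := OVSMD.scale_le_constM dx dy Mx My
  have hMsq := OVSMD.constM_sq dx dy Mx My
  rw [← hM] at hκxM hκyM hMsq
  have hM0 : 0 < M := hκx.trans_le hκxM
  obtain ⟨hL, he1, he2⟩ := OVSMD.constOmega_bounds hδ
  set L := OVSMD.constOmega δ with hLdef
  have hQ := hA.Q_pos
  have hδ0 : 0 < δ := hδ.1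
  have ha : ENNReal.ofReal (Real.exp (-(L ^ 2 / 4))) ≤ ENNReal.ofReal (δ / 24) :=
    ENNReal.ofReal_le_ofReal he1
  have hb : ENNReal.ofReal (Real.exp (-(3 / 4 * L))) ≤ ENNReal.ofReal (δ / 24) :=
    ENNReal.ofReal_le_ofReal he2
  have hsix : 6 * ENNReal.ofReal (δ / 24) ≤ ENNReal.ofReal δ := by
    rw [show (6 : ENNReal) = ENNReal.ofReal 6 by norm_num, ← ENNReal.ofReal_mul (by norm_num)]
    exact ENNReal.ofReal_le_ofReal (by linarith)
  have hAm := hrun.measurable_state hm hX hA.F'_measurable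
  have hGxm := OVSMD.measurable_Gx p hA.F'_measurable
  have hGym := p.measurable_Gy
  have hvx : Measurable fun b : p.X × OVSMD.simplex (m + 1) => (b.1 : OVSMD.Vec d) := by fun_prop
  have hvy : Measurable fun b : p.X × OVSMD.simplex (m + 1) => (b.2 : OVSMD.Vec (m + 1)) := by
    fun_prop
  have hγ0 : ∀ s, 0 < γ s := fun s => by
    rw [hγ]
    have : 0 < Real.sqrt ((s : ℝ) + 1) := Real.sqrt_pos.2 (by positivity)
    positivity
  have hΓ : ∀ t, 0 < ∑ s ∈ Finset.range (t + 1), γ s := fun t =>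
    Finset.sum_pos (fun s _ => hγ0 s) (by simp)
  refine ⟨fun t ht => ?_, fun t ht => ?_⟩
  · obtain ⟨hS1, ρ, hρ, hρ2, hρ1, hρH⟩ := OVSMD.stepsize_sums hM0 hγ t
    have hit := OVSMD.mul_sum_inv_le_of_iterBound (by positivity) hε ht
    rw [← hS1, mul_left_comm] at hit
    have hbud := OVSMD.gap_budget hM0 hκxM hκyM hMsq hL hρ hρ1 hρH hit
    have hx := dx.measure_regret_gt_le p.isClosed p.convex hX hξ hlaw hind hAm hGxm
      (fun b => (hA.G_integrable b.1 b.1.2 b.2 b.2.2).1) hA.Mx_pos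
      (fun b => hA.Gx_tail b.1 b.1.2 b.2 b.2.2) hvx (fun b => b.1.2) (γ := γ) hrun.init_x
      hrun.step_x (t + 1) hρ hρ2 hL (3 / 4 * L)
    -- The y-block ascends, so its oracle is -G_y; the dual norm, and hence the tail bound, is
    -- unchanged.
    have hy := dy.measure_regret_gt_le hYcl hYco hY hξ hlaw hind hAm hGym.neg
      (fun b => (hA.G_integrable b.1 b.1.2 b.2 b.2.2).2.neg) hA.My_pos
      (fun b => by simpa only [Pi.neg_apply, OVSMD.dualNorm_neg dy.definite] using hA.Gy_tail b.1 b.1.2)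
      hvy (fun b => b.2.2) (γ := γ) hrun.init_y hrun.step_y (t + 1) hρ hρ2 hL (3 / 4 * L)
    refine (measure_mono ?_).trans ((measure_union_le _ _).trans ((add_le_add hx hy).trans
      (le_trans ?_ hsix)))
    · intro o ho
      by_contra hcon
      simp only [mem_union, mem_ofPred_eq, not_or, not_lt, not_exists, not_and] at hcon
      obtain ⟨h1, h2⟩ := hcon
      rw [mem_ofPred_eq, ← not_le] at ho
      refine ho ?_
      -- The good event is uniform in each comparator, so wx and wy may be chosen independently. The
      -- values φ cancel in the difference of averages, leaving the sum of the two regrets.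
      refine OVSMD.sSup_sub_sInf_le hY.nonempty hX.nonempty fun wy hwy wx hwx => ?_
      rw [OVSMD.wavg_sub, div_le_iff₀ (hΓ t)]
      refine le_trans ?_ ((add_le_add (h1 wx hwx) (h2 wy hwy)).trans hbud)
      rw [← Finset.sum_add_distrib]
      refine Finset.sum_le_sum fun s _ => le_of_eq ?_
      have e1 : ∫ e, OVSMD.Gx F' (x s o) (y s o) e ∂p.law = p.gx F' (x s o) (y s o) := rfl
      have e2 : ∫ e, -p.Gy (x s o) e ∂p.law = -p.gy (x s o) := integral_neg _
      simp only [OVSMD.IsRun.state, Pi.neg_apply, e1, e2, inner_neg_left, inner_sub_right]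
      ring
    · calc _ ≤ (ENNReal.ofReal (δ / 24) + ENNReal.ofReal (δ / 24) + ENNReal.ofReal (δ / 24)) +
          (ENNReal.ofReal (δ / 24) + ENNReal.ofReal (δ / 24) + ENNReal.ofReal (δ / 24)) := by
            gcongr
        _ = _ := by ring
  · obtain ⟨hS1, ρ, hρ, hρ2, hρ1, hρH⟩ := OVSMD.stepsize_sums hM0 hγ t
    have hit := OVSMD.mul_sum_inv_le_of_iterBound (by positivity) hε ht
    rw [← hS1, mul_left_comm] at hit
    have hsum : 4 * ENNReal.ofReal (Real.exp (-(L ^ 2 / 4))) +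
        2 * ENNReal.ofReal (Real.exp (-(3 / 4 * L))) ≤ ENNReal.ofReal δ := by
      refine le_trans ?_ hsix
      calc _ ≤ 4 * ENNReal.ofReal (δ / 24) + 2 * ENNReal.ofReal (δ / 24) := by gcongr
        _ = _ := by ring
    have hPhim := p.measurable_Phi
    constructor
    · have hx := dx.measure_validation_gt_le
        (G := fun q : (p.X × OVSMD.simplex (m + 1)) × (∀ i, Ξ i) => OVSMD.Gx F' q.1.1 q.1.2 q.2)
        (v := fun b => (b.1 : OVSMD.Vec d)) (Φ := fun q => p.Phi q.1.1 q.1.2 q.2)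
        p.isClosed p.convex hX hξ hlaw hind hAm hGxm
        (fun b => (hA.G_integrable b.1 b.1.2 b.2 b.2.2).1) hA.Mx_pos
        (fun b => hA.Gx_tail b.1 b.1.2 b.2 b.2.2) hvx (fun b => b.1.2) hPhim
        (fun b => p.integrable_Phi b.1.2 b.2) hQ (fun b => hA.Phi_tail b.1 b.1.2 b.2 b.2.2) γ (t + 1)
        hρ hρ2 hL (3 / 4 * L)
      refine (measure_mono ?_).trans (hx.trans hsum)
      intro o ho
      by_contra hcon
      simp only [mem_ofPred_eq, not_lt, not_exists, not_and] at hcon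
      rw [mem_ofPred_eq, ← not_le] at ho
      refine ho ?_
      -- Compactness of the block makes both infima genuine, and their difference is bounded by the
      -- uniform error of the affine functions.
      refine OVSMD.abs_sInf_sub_sInf_le hX.nonempty
        (hXK.bddBelow_image (OVSMD.continuous_wavg_affine _ _ _ _ _).continuousOn)
        (hXK.bddBelow_image (OVSMD.continuous_wavg_affine _ _ _ _ _).continuousOn) fun w hw => ?_
      rw [OVSMD.wavg_sub, abs_div, abs_of_pos (hΓ t), div_le_iff₀ (hΓ t)]
      refine le_trans (le_of_eq ?_) ((hcon w hw).trans
        (OVSMD.validation_budget hM0 hκx hκxM hQ hL hρ hρ1 hρH hit))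
      congr 1
      refine Finset.sum_congr rfl fun s _ => ?_
      have e1 : ∫ e, OVSMD.Gx F' (x s o) (y s o) e ∂p.law = p.gx F' (x s o) (y s o) := rfl
      have e2 : ∫ e, p.Phi (x s o) (y s o) e ∂p.law = p.phi (x s o) (y s o) := rfl
      simp only [OVSMD.IsRun.state, e1, e2, inner_sub_left]
      ring
    · have hy := dy.measure_validation_gt_le
        (G := fun q : (p.X × OVSMD.simplex (m + 1)) × (∀ i, Ξ i) => p.Gy q.1.1 q.2)
        (v := fun b => (b.2 : OVSMD.Vec (m + 1))) (Φ := fun q => p.Phi q.1.1 q.1.2 q.2)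
        hYcl hYco hY hξ hlaw hind hAm hGym
        (fun b => (hA.G_integrable b.1 b.1.2 b.2 b.2.2).2) hA.My_pos
        (fun b => hA.Gy_tail b.1 b.1.2) hvy (fun b => b.2.2) hPhim
        (fun b => p.integrable_Phi b.1.2 b.2) hQ (fun b => hA.Phi_tail b.1 b.1.2 b.2 b.2.2) γ (t + 1)
        hρ hρ2 hL (3 / 4 * L)
      refine (measure_mono ?_).trans (hy.trans hsum)
      intro o ho
      by_contra hcon
      simp only [mem_ofPred_eq, not_lt, not_exists, not_and] at hcon
      rw [mem_ofPred_eq, ← not_le] at ho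
      refine ho ?_
      refine OVSMD.abs_sSup_sub_sSup_le hY.nonempty
        (hYK.bddAbove_image (OVSMD.continuous_wavg_affine _ _ _ _ _).continuousOn)
        (hYK.bddAbove_image (OVSMD.continuous_wavg_affine _ _ _ _ _).continuousOn) fun w hw => ?_
      rw [OVSMD.wavg_sub, abs_div, abs_of_pos (hΓ t), div_le_iff₀ (hΓ t)]
      refine le_trans (le_of_eq ?_) ((hcon w hw).trans
        (OVSMD.validation_budget hM0 hκy hκyM hQ hL hρ hρ1 hρH hit))
      congr 1
      refine Finset.sum_congr rfl fun s _ => ?_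
      have e1 : ∫ e, p.Gy (x s o) e ∂p.law = p.gy (x s o) := rfl
      have e2 : ∫ e, p.Phi (x s o) (y s o) e ∂p.law = p.phi (x s o) (y s o) := rfl
      simp only [OVSMD.IsRun.state, e1, e2, inner_sub_left]
      ring
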